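/- Let $n,p,q\ge 0$ be integers, let $F_n$ be the free group of rank $n$, and let $V$ be a vector space over $\mathbb{Q}$. Let $\mathcal{G}_n^{1+q}$ be the moduli space of connected graphs $\Gamma$ homotopy equivalent to $\bigvee^n S^1$ with $1+q$ marked points, that is, up to homotopy, the classifying space $BA_n^{1+q}$ of the group $A_n^{1+q}=\mathrm{Aut}(F_n)\ltimes F_n^{q}$, where $\mathrm{Aut}(F_n)$ acts diagonally on $F_n^{q}$. Let $\pi:\mathcal{G}_n^{1+q}\to\mathcal{G}_n^1=B\mathrm{Aut}(F_n)$ be the map that forgets the last $q$ marked points, that is, the fibration of classifying spaces (nerves) induced by the projection $A_n^{1+q}\to\mathrm{Aut}(F_n)$; its fibre over $\Gamma$ is $\Gamma^{\times q}\simeq B(F_n^{q})$. Let $\bigwedge^p(H_1(\Gamma)\otimes V)$ be the local system on $\mathcal{G}_n^1$ given by the representation $\bigwedge^p(H_1(F_n;\mathbb{Q})\otimes V)$ of $\mathrm{Aut}(F_n)$, where $\mathrm{Aut}(F_n)$ acts trivially on $V$; its pullback along $\pi$ is denoted in the same way. Consider the Serre spectral sequence of $\pi$ with these coefficients, $$E_2^{a,b}=H^a\left(\mathcal{G}_n^1;\,H^b(\Gamma^{\times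 q};\mathbb{Q})\otimes\textstyle\bigwedge^p(H_1(\Gamma)\otimes V)\right)\Longrightarrow H^{a+b}\left(\mathcal{G}_n^{1+q};\,\textstyle\bigwedge^p(H_1(\Gamma)\otimes V)\right),$$ that is, the spectral sequence of the complex of cochains on $\mathcal{G}_n^{1+q}$ with values in the pulled back local system, filtered by the subcomplexes $F^a$ of the cochains that vanish on the preimage under $\pi$ of the $(a-1)$-skeleton of $\mathcal{G}_n^1$. Then this spectral sequence degenerates on the $E_2$-page: for all $r\ge 2$, all differentials $d_r:E_r^{a,b}\to E_r^{a+r,b-r+1}$ are zero. -/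

import Mathlib

open CategoryTheory Opposite Simplicial
open scoped TensorProduct

universe v

noncomputable section

/-! ## Local systems on simplicial sets and their cochains -/

/-- A local system of rational vector spaces on a simplicial set `X`: a vector space `L σ` for every
simplex `σ`, together with compatible maps `L (φ^* σ) → L σ` for all simplicial operators `φ`, all
of which are isomorphisms. -/
structure LocalSystem (X : SSet.{0}) where
  functor : X.Elementsᵒᵖ ⥤ ModuleCat.{v} ℚ
  isIso_map : ∀ {x y : X.Elementsᵒᵖ} (f : x ⟶ y), IsIso (functor.map f)

namespace LocalSystem

variable {X Y : SSet.{0}}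

/-- The vector space that a local system attaches to a simplex. -/
abbrev stalk (L : LocalSystem.{v} X) {Δ : SimplexCategory} (σ : X.obj (op Δ)) : ModuleCat.{v} ℚ :=
  L.functor.obj (op (X.elementsMk (op Δ) σ))

/-- The map `L (φ^* σ) → L σ`. -/
def transport (L : LocalSystem.{v} X) {Δ Δ' : SimplexCategory} (φ : Δ ⟶ Δ')
    (σ : X.obj (op Δ')) : L.stalk (X.map φ.op σ) ⟶ L.stalk σ :=
  L.functor.map (Quiver.Hom.op
    (CategoryOfElements.homMk (X.elementsMk (op Δ') σ) (X.elementsMk (op Δ) (X.map φ.op σ))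
      φ.op rfl))

/-- The pullback `f^* L` of a local system along a map of simplicial sets. -/
def pullback (f : X ⟶ Y) (L : LocalSystem.{v} Y) : LocalSystem.{v} X where
  functor := (CategoryOfElements.map f).op ⋙ L.functor
  isIso_map _ := L.isIso_map _

lemma map_apply_congr (L : LocalSystem.{v} X) {Δ : SimplexCategory} {y : X.Elements}
    (c : ∀ τ : X.obj (op Δ), L.stalk τ) {τ τ' : X.obj (op Δ)} (h : τ = τ')
    (f : y ⟶ X.elementsMk (op Δ) τ) (f' : y ⟶ X.elementsMk (op Δ) τ') (hf : f.1 = f'.1) :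
    (L.functor.map f.op).hom (c τ) = (L.functor.map f'.op).hom (c τ') := by
  subst h
  have : f = f' := Subtype.ext hf
  rw [this]

/-- The cosimplicial vector space `[n] ↦ ∏_{σ ∈ X_n} L σ`. -/
def cosimplicial (L : LocalSystem.{v} X) : CosimplicialObject (ModuleCat.{v} ℚ) where
  obj Δ := ModuleCat.of ℚ (∀ σ : X.obj (op Δ), L.stalk σ)
  map {Δ Δ'} φ := ModuleCat.ofHom
    (LinearMap.pi fun σ : X.obj (op Δ') =>
      (L.transport φ σ).hom ∘ₗ LinearMap.proj (X.map φ.op σ))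
  map_id Δ := by
    refine ModuleCat.hom_ext (LinearMap.ext fun c => funext fun σ => ?_)
    have h := L.map_apply_congr c (τ := X.map (𝟙 Δ).op σ) (τ' := σ) (by simp)
      (CategoryOfElements.homMk (X.elementsMk (op Δ) σ) (X.elementsMk (op Δ) _) (𝟙 Δ).op rfl)
      (𝟙 _) rfl
    refine h.trans ?_
    simp
  map_comp {Δ Δ' Δ''} φ ψ := by
    refine ModuleCat.hom_ext (LinearMap.ext fun c => funext fun σ => ?_)
    have h := L.map_apply_congr c (τ := X.map (φ ≫ ψ).op σ) (τ' := X.map φ.op (X.map ψ.op σ))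
      (by simp)
      (CategoryOfElements.homMk (X.elementsMk (op Δ'') σ) (X.elementsMk (op Δ) _) (φ ≫ ψ).op rfl)
      (CategoryOfElements.homMk (X.elementsMk (op Δ'') σ)
          (X.elementsMk (op Δ') (X.map ψ.op σ)) ψ.op rfl ≫
        CategoryOfElements.homMk (X.elementsMk (op Δ') (X.map ψ.op σ))
          (X.elementsMk (op Δ) (X.map φ.op (X.map ψ.op σ))) φ.op rfl)
      rfl
    refine h.trans ?_
    rw [op_comp, Functor.map_comp]
    rfl

/-- The complex `C^*(X; L)` of simplicial cochains, with `C^n(X; L) = ∏_{σ ∈ X_n} L σ` and the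
alternating sum of the cofaces as differential. -/
def cochains (L : LocalSystem.{v} X) : CochainComplex (ModuleCat.{v} ℚ) ℕ :=
  (AlgebraicTopology.alternatingCofaceMapComplex _).obj L.cosimplicial

/-- A simplex of the nerve of `C` as a sequence of composable arrows. -/
abbrev arrows {C : Type} [Category.{0} C] (x : (nerve C).Elements) :
    ComposableArrows C x.1.unop.len :=
  x.2

/-- The functor that takes a simplex `x_0 → ⋯ → x_n` of the nerve of `C` to its last vertex `x_n`,
and an operator `φ : [m] → [n]` to the composite `x_{φ(m)} → ⋯ → x_n`. -/
def lastVertex (C : Type) [Category.{0} C] : (nerve C).Elementsᵒᵖ ⥤ C where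
  obj x := (arrows x.unop).obj (Fin.last _)
  map {x y} f :=
    eqToHom (congrArg (fun τ : ComposableArrows C x.unop.1.unop.len => τ.obj (Fin.last _))
      f.unop.2.symm) ≫
    (arrows y.unop).map
      (homOfLE (Fin.le_last (f.unop.1.unop.toOrderHom (Fin.last x.unop.1.unop.len))))
  map_id x := by
    refine (Category.id_comp _).trans ?_
    exact (arrows x.unop).map_id _
  map_comp {x y z} f g := by
    obtain ⟨⟨⟨Δ⟩, σ⟩⟩ := x
    obtain ⟨⟨⟨Δ'⟩, τ⟩⟩ := y
    obtain ⟨⟨⟨Δ''⟩, υ⟩⟩ := z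
    obtain ⟨f⟩ := f
    obtain ⟨g⟩ := g
    change {φ : op Δ' ⟶ op Δ // (nerve C).map φ τ = σ} at f
    change {ψ : op Δ'' ⟶ op Δ' // (nerve C).map ψ υ = τ} at g
    obtain ⟨φ, hφ⟩ := f
    obtain ⟨ψ, hψ⟩ := g
    subst hψ
    subst hφ
    refine (Category.id_comp _).trans ?_
    refine Eq.trans ?_ (congrArg₂ (· ≫ ·) (Category.id_comp _) (Category.id_comp _)).symm
    exact (Functor.map_comp (C := Fin (Δ''.len + 1)) υ _ _)

/-- The local system on the nerve of a groupoid `C` that is given by a functor `F` on `C`: its value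
on `x_0 → ⋯ → x_n` is `F x_n`. -/
def ofFunctor {C : Type} [Groupoid.{0} C] (F : C ⥤ ModuleCat.{v} ℚ) :
    LocalSystem.{v} (nerve C) where
  functor := lastVertex C ⋙ F
  isIso_map _ := inferInstanceAs (IsIso (F.map _))

end LocalSystem

/-! ## The spectral sequence of a filtered complex -/

namespace FilteredComplex

variable (K : CochainComplex (ModuleCat.{v} ℚ) ℕ) (F : ℤ → (n : ℕ) → Submodule ℚ (K.X n))

/-- `Z_r^a` in total degree `n`: the `x ∈ F^a K^n` with `dx ∈ F^{a+r} K^{n+1}`. -/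
def cycles (r a : ℤ) (n : ℕ) : Submodule ℚ (K.X n) :=
  F a n ⊓ (F (a + r) (n + 1)).comap (K.d n (n + 1)).hom

/-- `Z_{r-1}^{a+1} + d Z_{r-1}^{a-r+1}` in total degree `n`
(for `n = 0` the differential `K.d (n - 1) n` is zero). -/
def boundaries (r a : ℤ) (n : ℕ) : Submodule ℚ (K.X n) :=
  cycles K F (r - 1) (a + 1) n ⊔
    (cycles K F (r - 1) (a - r + 1) (n - 1)).map (K.d (n - 1) n).hom

/-- The term `E_r^{a,b}`, where `n = a + b` is the total degree, of the spectral sequence of the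
complex `K` with the decreasing filtration `F`. -/
abbrev page (r a : ℤ) (n : ℕ) : Type v :=
  cycles K F r a n ⧸ (boundaries K F r a n).submoduleOf (cycles K F r a n)

lemma d_mem_cycles (r a : ℤ) (n : ℕ) (x : K.X n) (hx : x ∈ cycles K F r a n) :
    (K.d n (n + 1)).hom x ∈ cycles K F r (a + r) (n + 1) := by
  refine ⟨hx.2, ?_⟩
  have h : (K.d (n + 1) (n + 1 + 1)).hom ((K.d n (n + 1)).hom x) = 0 := by
    rw [← LinearMap.comp_apply, ← ModuleCat.hom_comp, K.d_comp_d]; rfl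
  change (K.d (n + 1) (n + 1 + 1)).hom ((K.d n (n + 1)).hom x) ∈ F (a + r + r) (n + 1 + 1)
  rw [h]
  exact Submodule.zero_mem _

/-- The differential `d_r : E_r^{a,b} → E_r^{a+r,b-r+1}`, induced by the differential of `K`. -/
def d (r a : ℤ) (n : ℕ) : page K F r a n →ₗ[ℚ] page K F r (a + r) (n + 1) :=
  Submodule.mapQ _ _
    ((K.d n (n + 1)).hom.restrict fun x hx => d_mem_cycles K F r a n x hx) (by
      rintro ⟨x, hx⟩ hxb
      obtain ⟨u, hu, w, ⟨y, -, rfl⟩, rfl⟩ := Submodule.mem_sup.1 hxb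
      have h : (K.d n (n + 1)).hom ((K.d (n - 1) n).hom y) = 0 := by
        rw [← LinearMap.comp_apply, ← ModuleCat.hom_comp, K.d_comp_d]; rfl
      refine Submodule.mem_sup_right ⟨u, ?_, ?_⟩
      · have e : a + r - r + 1 = a + 1 := by ring
        rw [e]
        exact hu
      · change (K.d n (n + 1)).hom u = (K.d n (n + 1)).hom (u + _)
        rw [map_add, h, add_zero])

/-- Degeneration on the page `E_{r₀}`: all differentials `d_r` with `r ≥ r₀` are zero. -/
def DegeneratesAt (r₀ : ℤ) : Prop :=
  ∀ r : ℤ, r₀ ≤ r → ∀ (a : ℤ) (n : ℕ), d K F r a n = 0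

end FilteredComplex

/-! ## The Serre spectral sequence -/

namespace Serre

variable {X Y : SSet.{0}}

/-- The Serre filtration on `C^*(X; L)` for a map `f : X → Y`: `F^a` consists of the cochains that
vanish on the preimage under `f` of the `(a-1)`-skeleton of `Y`
(Mathlib's `Y.skeleton a` is generated by the simplices of dimension `< a`). -/
def filtration (f : X ⟶ Y) (L : LocalSystem.{v} X) (a : ℤ) (n : ℕ) :
    Submodule ℚ (L.cochains.X n) where
  carrier := Set.ofPred fun c : (∀ σ : X _⦋n⦌, L.stalk σ) =>
    ∀ σ : X _⦋n⦌, f.app (op ⦋n⦌) σ ∈ (Y.skeleton a.toNat).obj (op ⦋n⦌) → c σ = 0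
  zero_mem' _ _ := rfl
  add_mem' {c c'} hc hc' σ hσ := by
    change c σ + c' σ = 0
    rw [hc σ hσ, hc' σ hσ, add_zero]
  smul_mem' t c hc σ hσ := by
    change t • c σ = 0
    rw [hc σ hσ, smul_zero]

/-- The Serre spectral sequence of `f : X → Y` with coefficients in the local system `L` on `X`,
that is, the spectral sequence of `C^*(X; L)` with the Serre filtration, degenerates on `E_2`. -/
def DegeneratesAtE₂ (f : X ⟶ Y) (L : LocalSystem.{v} X) : Prop :=
  FilteredComplex.DegeneratesAt L.cochains (filtration f L) 2

end Serre

/-! ## The classifying spaces of marked graphs -/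

namespace MarkedGraph

/-- The diagonal action of `Aut(F_n)` on `F_n^q`. -/
def diagonalAction (n q : ℕ) :
    MulAut (FreeGroup (Fin n)) →* MulAut (Fin q → FreeGroup (Fin n)) where
  toFun φ := MulEquiv.piCongrRight fun _ => φ
  map_one' := rfl
  map_mul' _ _ := rfl

/-- The group `A_n^{1+q} = Aut(F_n) ⋉ F_n^q` of homotopy classes, relative to the marked points, of
homotopy automorphisms of a graph of rank `n` with `1 + q` marked points. -/
abbrev A (n q : ℕ) : Type :=
  (Fin q → FreeGroup (Fin n)) ⋊[diagonalAction n q] MulAut (FreeGroup (Fin n))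

/-- The homotopy type of the moduli space `𝒢_n^{1+q}` of graphs of rank `n` with `1 + q` marked
points: the classifying space of `A_n^{1+q}`, as a simplicial set (a Kan complex). -/
abbrev G (n q : ℕ) : SSet.{0} := nerve (SingleObj (A n q))

/-- The space `𝒢_n^1`, as the classifying space of `Aut(F_n)`. -/
abbrev G₁ (n : ℕ) : SSet.{0} := nerve (SingleObj (MulAut (FreeGroup (Fin n))))

/-- The map `𝒢_n^{1+q} → 𝒢_n^1` that forgets the last `q` marked points. It is induced by the
projection `Aut(F_n) ⋉ F_n^q → Aut(F_n)`, hence is a Kan fibration, and its fibre is the classifying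
space of `F_n^q`, that is, `Γ^q` for a graph `Γ` of rank `n`. -/
def forget (n q : ℕ) : G n q ⟶ G₁ n :=
  nerveMap (SemidirectProduct.rightHom : A n q →* MulAut (FreeGroup (Fin n))).toFunctor

/-- `H_1(Γ; ℚ) = H_1(F_n; ℚ)` for a graph `Γ` with fundamental group `F_n`. -/
abbrev H₁ (n : ℕ) : Type := ℚ ⊗[ℤ] Additive (Abelianization (FreeGroup (Fin n)))

/-- The automorphism of `F_n^{ab} = H_1(F_n; ℤ)` induced by an automorphism of `F_n`. -/
def abMap {n : ℕ} (φ : MulAut (FreeGroup (Fin n))) :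
    Additive (Abelianization (FreeGroup (Fin n))) →ₗ[ℤ]
      Additive (Abelianization (FreeGroup (Fin n))) :=
  (MonoidHom.toAdditive (Abelianization.map φ.toMonoidHom)).toIntLinearMap

lemma abMap_one (n : ℕ) : abMap (1 : MulAut (FreeGroup (Fin n))) = LinearMap.id :=
  LinearMap.ext fun x =>
    congrArg Additive.ofMul (DFunLike.congr_fun
      (Abelianization.map_id (G := FreeGroup (Fin n))) x.toMul)

lemma abMap_mul {n : ℕ} (φ ψ : MulAut (FreeGroup (Fin n))) :
    abMap (φ * ψ) = abMap φ ∘ₗ abMap ψ :=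
  LinearMap.ext fun x =>
    congrArg Additive.ofMul (DFunLike.congr_fun
      (Abelianization.map_comp ψ.toMonoidHom φ.toMonoidHom).symm x.toMul)

/-- The action of `Aut(F_n)` on `H_1(F_n; ℚ)`. -/
def actionH₁ (n : ℕ) : Representation ℚ (MulAut (FreeGroup (Fin n))) (H₁ n) where
  toFun φ := (abMap φ).baseChange ℚ
  map_one' := by
    rw [abMap_one, LinearMap.baseChange_id]
    rfl
  map_mul' φ ψ := by
    rw [abMap_mul, LinearMap.baseChange_comp]
    rfl

/-- The functor `Aut(F_n) → Vect` that corresponds to the representation `⋀^p (H_1(F_n; ℚ) ⊗ V)`,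
where `Aut(F_n)` acts trivially on `V`. -/
def coefficientFunctor (n p : ℕ) (V : Type v) [AddCommGroup V] [Module ℚ V] :
    SingleObj (MulAut (FreeGroup (Fin n))) ⥤ ModuleCat.{v} ℚ where
  obj _ := ModuleCat.of ℚ (⋀[ℚ]^p (H₁ n ⊗[ℚ] V))
  map φ := ModuleCat.ofHom (exteriorPower.map p ((actionH₁ n φ).rTensor V))
  map_id _ := by
    rw [SingleObj.id_as_one, map_one, Module.End.one_eq_id, LinearMap.rTensor_id,
      exteriorPower.map_id]
    rfl
  map_comp φ ψ := by
    rw [SingleObj.comp_as_mul, map_mul, Module.End.mul_eq_comp, LinearMap.rTensor_comp,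
      exteriorPower.map_comp, ModuleCat.ofHom_comp]

/-- The local system `⋀^p (H_1(Γ; ℚ) ⊗ V)` on `𝒢_n^1`. -/
def coefficients (n p : ℕ) (V : Type v) [AddCommGroup V] [Module ℚ V] : LocalSystem.{v} (G₁ n) :=
  LocalSystem.ofFunctor (coefficientFunctor n p V)

end MarkedGraph

end

/-! Making the marked point i equal to the base point is an endomorphism of A_n^{1+q} over Aut(F_n),
namely `collapseHom i`. As the coefficients come from the base, these q commuting idempotents act on
the filtered cochain complex. They split it into summands indexed by the sets S of marked points:
the cochains that are reduced at the points of S and independent of the others. On the summand of S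
the fibre contributes only the reduced cohomology in the factors of S, which is H^1(F_n)^{⊗S}
because a free group has cohomological dimension one. Hence the first page of this summand sits in
the single row #S. For r ≥ 2 the differential d_r changes the row, so it vanishes.

In homogeneous coordinates a cochain is an equivariant function on lists of vertices, the
differential is the untwisted alternating sum over faces (`coord_d`), and F^a consists of the
cochains that vanish on lists whose image in Aut(F_n) has at most a constant runs (`mem_F_iff`).
Vanishing off the row #S is `exists_sub_d_mem_F`. It rests on `exists_fil_sub_d_of_reduced`, which
concerns F_n^q-invariant functions and goes by induction on S. A prism homotopy towards the
collapsed cochain gives a primitive that may fail to be invariant; the failure is a coboundary by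
induction, and `FreeGroup.exists_primitive` turns it into a correction. The case S = ∅ is
`exists_fil_sub_d`, the cohomology of successive skeleta of the base. Equivariance under Aut(F_n) is
restored afterwards by normalizing the first vertex.

The pages themselves are never split: `degeneratesAt_of_lift` reduces degeneration to a lifting
property of single cochains, and `exists_lift` checks it summand by summand. -/

noncomputable section

/-! ## Cochains on lists -/

/-- The number of maximal constant runs of a list. -/
def runs {Q : Type*} (l : List Q) : ℕ :=
  match l with
  | [] => 0
  | x :: l => runs l + open Classical in if l.head? = some x then 0 else 1

section Runs

variable {Q : Type*}

lemma runs_cons_of_head (x : Q) (l : List Q) (h : l.head? = some x) : runs (x :: l) = runs l := by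
  simp [runs, h]

lemma runs_cons_of_head_ne (x : Q) (l : List Q) (h : l.head? ≠ some x) :
    runs (x :: l) = runs l + 1 := by
  simp [runs, h]

lemma runs_cons_cons_self (x : Q) (l : List Q) : runs (x :: x :: l) = runs (x :: l) :=
  runs_cons_of_head _ _ rfl

lemma runs_le_cons (x : Q) (l : List Q) : runs l ≤ runs (x :: l) :=
  Nat.le_add_right _ _

lemma runs_cons_le (x : Q) (l : List Q) : runs (x :: l) ≤ runs l + 1 := by
  by_cases h : l.head? = some x
  · rw [runs_cons_of_head _ _ h]; omega
  · rw [runs_cons_of_head_ne _ _ h]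

lemma runs_append_dup (p : List Q) (x : Q) (t : List Q) :
    runs (p ++ x :: x :: t) = runs (p ++ x :: t) := by
  induction p with
  | nil => exact runs_cons_cons_self x t
  | cons y p ih =>
    have h : (p ++ x :: x :: t).head? = (p ++ x :: t).head? := by cases p <;> rfl
    rw [List.cons_append, List.cons_append, runs, runs, ih, h]

/-- Deleting entries can only remove or merge runs. This is what makes the filtration by runs
compatible with `d`. -/
lemma runs_le_of_sublist {l l' : List Q} (h : l'.Sublist l) : runs l' ≤ runs l := by
  induction l generalizing l' with
  | nil => rw [List.sublist_nil.1 h]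
  | cons y t ih =>
    rcases List.sublist_cons_iff.1 h with h₁ | ⟨r, rfl, h₁⟩
    · exact (ih h₁).trans (runs_le_cons _ _)
    · by_cases ht : t.head? = some y
      · obtain ⟨t₂, rfl⟩ : ∃ t₂, t = y :: t₂ := by
          cases t with
          | nil => simp at ht
          | cons z t => exact ⟨t, by simpa using ht⟩
        rw [runs_cons_cons_self]
        rcases List.sublist_cons_iff.1 h₁ with h₂ | ⟨r', rfl, -⟩
        · exact ih (h₂.cons_cons y)
        · rw [runs_cons_cons_self]
          exact ih h₁
      · rw [runs_cons_of_head_ne _ _ ht]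
        exact (runs_cons_le _ _).trans (Nat.succ_le_succ (ih h₁))

lemma one_le_runs {l : List Q} (hl : l ≠ []) : 1 ≤ runs l := by
  obtain ⟨x, t, rfl⟩ := List.exists_cons_of_ne_nil hl
  simpa [runs] using runs_le_of_sublist (l := x :: t) (l' := [x]) (by simp)

lemma runs_map_of_injective {Q' : Type*} (φ : Q → Q') (hφ : Function.Injective φ) (l : List Q) :
    runs (l.map φ) = runs l := by
  induction l with
  | nil => rfl
  | cons x l ih =>
    have h : (l.map φ).head? = some (φ x) ↔ l.head? = some x := by
      rw [List.head?_map]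
      cases l.head? <;> simp [hφ.eq_iff]
    rw [List.map_cons]
    by_cases hl : l.head? = some x
    · rw [runs_cons_of_head _ _ hl, runs_cons_of_head _ _ (h.2 hl), ih]
    · rw [runs_cons_of_head_ne _ _ hl, runs_cons_of_head_ne _ _ (mt h.1 hl), ih]

lemma runs_map_le {Q' : Type*} (φ : Q → Q') (l : List Q) : runs (l.map φ) ≤ runs l := by
  induction l with
  | nil => rfl
  | cons x l ih =>
    rw [List.map_cons]
    by_cases h : l.head? = some x
    · rw [runs_cons_of_head _ _ h, runs_cons_of_head _ _ (by rw [List.head?_map, h]; rfl)]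
      exact ih
    · rw [runs_cons_of_head_ne _ _ h]
      exact (runs_cons_le _ _).trans (Nat.succ_le_succ ih)

end Runs

namespace ListCochain

variable {V W M : Type*} [AddCommGroup M]

/-- The alternating sum of the values of `f` on the faces of a list. -/
def d (f : List V → M) (l : List V) : M :=
  match l with
  | [] => 0
  | x :: l => f l - d (fun l' => f (x :: l')) l

lemma d_nil (f : List V → M) : d f [] = 0 := rfl

lemma d_cons (f : List V → M) (x : V) (l : List V) :
    d f (x :: l) = f l - d (fun l' => f (x :: l')) l := rfl

lemma d_congr {f g : List V → M} {l : List V} (h : ∀ l', l'.Sublist l → f l' = g l') :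
    d f l = d g l := by
  induction l generalizing f g with
  | nil => rfl
  | cons x l ih =>
    rw [d_cons, d_cons, h l (List.sublist_cons_self x l),
      ih fun l' hl' => h _ (hl'.cons_cons x)]

lemma d_zero (l : List V) : d (fun _ => (0 : M)) l = 0 := by
  induction l with
  | nil => rfl
  | cons x l ih => rw [d_cons, ih, sub_zero]

lemma d_sub (f g : List V → M) (l : List V) : d (fun l => f l - g l) l = d f l - d g l := by
  induction l generalizing f g with
  | nil => simp [d_nil]
  | cons x l ih => rw [d_cons, d_cons, d_cons, ih]; abel

lemma d_neg (f : List V → M) (l : List V) : d (fun l => -f l) l = -d f l := by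
  have h := d_sub (fun _ => 0) f l
  simpa [d_zero] using h

lemma d_add (f g : List V → M) (l : List V) : d (fun l => f l + g l) l = d f l + d g l := by
  have h := d_sub f (fun l => -g l) l
  simpa [d_neg] using h

lemma d_map (φ : V → W) (f : List W → M) (l : List V) :
    d (fun l => f (l.map φ)) l = d f (l.map φ) := by
  induction l generalizing f with
  | nil => rfl
  | cons x l ih =>
    rw [List.map_cons, d_cons, d_cons, ← ih fun l' => f (φ x :: l')]
    rfl

lemma d_d (f : List V → M) (l : List V) : d (d f) l = 0 := by
  induction l generalizing f with
  | nil => rfl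
  | cons x l ih =>
    rw [d_cons]
    simp only [d_cons, d_sub, ih]
    abel

lemma d_eq_zero_of_length {f : List V → M} {n : ℕ} (hf : ∀ l, l.length = n → f l = 0)
    (l : List V) (hl : l.length = n + 1) : d f l = 0 := by
  induction l generalizing f n with
  | nil => rfl
  | cons x l ih =>
    have hl' : l.length = n := by simpa using hl
    rw [d_cons, hf l hl', zero_sub, neg_eq_zero]
    cases n with
    | zero => rw [List.length_eq_zero_iff.1 hl', d_nil]
    | succ n => exact ih (fun l' h => hf _ (by simp [h])) hl'

/-- The prism operator of the homotopy from the identity to `e`. -/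
def prism (e : V → V) (f : List V → M) (l : List V) : M :=
  match l with
  | [] => 0
  | x :: l => f (x :: e x :: l.map e) - prism e (fun l' => f (x :: l')) l

lemma prism_cons (e : V → V) (f : List V → M) (x : V) (l : List V) :
    prism e f (x :: l) = f (x :: e x :: l.map e) - prism e (fun l' => f (x :: l')) l := rfl

lemma prism_sub (e : V → V) (f g : List V → M) (l : List V) :
    prism e (fun l => f l - g l) l = prism e f l - prism e g l := by
  induction l generalizing f g with
  | nil => simp [prism]
  | cons x l ih => rw [prism_cons, prism_cons, prism_cons, ih]; abel

lemma prism_zero (e : V → V) (l : List V) : prism e (fun _ => (0 : M)) l = 0 := by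
  simpa using prism_sub e (fun _ => (0 : M)) (fun _ => 0) l

lemma prism_eq_zero {e : V → V} {f : List V → M} {l : List V}
    (h : ∀ p x t, l = p ++ x :: t → f (p ++ x :: e x :: t.map e) = 0) : prism e f l = 0 := by
  induction l generalizing f with
  | nil => rfl
  | cons x l ih =>
    have h₀ : f (x :: e x :: l.map e) = 0 := h [] x l rfl
    rw [prism_cons, h₀, ih, sub_zero]
    rintro p y t rfl
    exact h (x :: p) y t rfl

lemma prism_map {e φ : V → V} (h : ∀ x, φ (e x) = e (φ x)) (f : List V → M) (l : List V) :
    prism e (fun l => f (l.map φ)) l = prism e f (l.map φ) := by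
  induction l generalizing f with
  | nil => rfl
  | cons x l ih =>
    have h' : φ ∘ e = e ∘ φ := funext h
    rw [List.map_cons, prism_cons, prism_cons, ← ih fun l' => f (φ x :: l')]
    simp only [List.map_cons, List.map_map, h, h']

lemma d_prism_add_prism_d (e : V → V) (f : List V → M) (l : List V) :
    d (prism e f) l + prism e (d f) l = f (l.map e) - f l := by
  induction l generalizing f with
  | nil => simp [d_nil, prism]
  | cons x l ih =>
    have h := ih fun l' => f (x :: l')
    simp only [d_cons, prism_cons, prism_sub, d_sub, List.map_cons,
      d_map e fun l' => f (x :: e x :: l')] at h ⊢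
    rw [sub_eq_iff_eq_add.1 h.symm]
    abel

/-! ### The filtration by the number of runs -/

section Fil

variable {Q : Type*} (κ : V → Q)

/-- The cochains that vanish on the lists with fewer than `k` runs in `Q`. -/
def Fil (k : ℕ) (f : List V → M) : Prop :=
  ∀ l : List V, runs (l.map κ) < k → f l = 0

variable {κ} {k : ℕ} {f g : List V → M}

lemma Fil.sub (hf : Fil κ k f) (hg : Fil κ k g) : Fil κ k fun l => f l - g l :=
  fun l hl => by simp only [hf l hl, hg l hl, sub_zero]

lemma Fil.neg (hf : Fil κ k f) : Fil κ k fun l => -f l :=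
  fun l hl => by simp only [hf l hl, neg_zero]

lemma Fil.d (hf : Fil κ k f) : Fil κ k (d f) := fun l hl => by
  rw [← d_zero l]
  exact d_congr fun l' hl' => hf _ ((runs_le_of_sublist (hl'.map κ)).trans_lt hl)

lemma Fil.comp {φ : V → V} (hφ : ∀ l : List V, runs ((l.map φ).map κ) = runs (l.map κ))
    (hf : Fil κ k f) : Fil κ k fun l => f (l.map φ) :=
  fun l hl => hf _ (by rwa [hφ])

/-- The prism only inserts `e x` next to `x`, in the same fibre of `κ`, so it creates no new run. -/
lemma Fil.prism {e : V → V} (he : ∀ x, κ (e x) = κ x) (hf : Fil κ k f) :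
    Fil κ k (prism e f) := by
  refine fun l hl => prism_eq_zero ?_
  rintro p x t rfl
  have h : κ ∘ e = κ := funext he
  refine hf _ ?_
  simp only [List.map_append, List.map_cons, List.map_map, he, h, runs_append_dup] at hl ⊢
  exact hl

end Fil

/-- The cochains on the lists in `Q` with exactly `k` runs only have cohomology in length `k`. -/
theorem exists_fil_sub_d {Q : Type*} (k : ℕ) (f : List Q → M) (hf : Fil id k f)
    (hdf : Fil id (k + 1) (d f)) (hk : ∀ l, l.length = k → f l = 0) :
    ∃ g : List Q → M, Fil id k g ∧ Fil id (k + 1) fun l => f l - d g l := by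
  classical
  induction k generalizing f with
  | zero =>
    refine ⟨fun _ => 0, fun _ _ => rfl, fun l hl => ?_⟩
    obtain rfl : l = [] := by
      by_contra h
      rw [List.map_id, Nat.lt_one_iff] at hl
      have := one_le_runs h
      omega
    change f [] - d _ [] = 0
    rw [hk [] rfl, d_nil, sub_zero]
  | succ k ih =>
    simp only [Fil, List.map_id] at hf hdf ih ⊢
    -- Doubling the first vertex is a contraction along the first run. Subtracting `d s` makes the
    -- cochain vanish on lists that start with a repetition.
    let s : List Q → M := fun l => match l with
      | [] => 0
      | x :: l => f (x :: x :: l)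
    have hs : ∀ l, runs l < k + 1 → s l = 0 := by
      rintro (_ | ⟨x, l⟩) hl
      · rfl
      · exact hf _ (by rwa [runs_cons_cons_self])
    have hsl : ∀ l, l.length = k → s l = 0 := by
      rintro (_ | ⟨x, l⟩) hl
      · rfl
      · exact hk _ (by simpa using hl)
    obtain ⟨f₁, hf₁⟩ : ∃ f₁ : List Q → M, f₁ = fun l => f l - d s l := ⟨_, rfl⟩
    have hds : ∀ l, runs l < k + 1 → d s l = 0 := by
      have : Fil id (k + 1) s := fun l hl => hs l (by simpa using hl)
      exact fun l hl => this.d l (by simpa using hl)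
    have hfil : ∀ l, runs l < k + 1 → f₁ l = 0 := fun l hl => by
      simp only [hf₁, hf l hl, hds l hl, sub_zero]
    have hdfil : ∀ l, runs l < k + 2 → d f₁ l = 0 := fun l hl => by
      rw [hf₁, d_sub, d_d, hdf l hl, sub_zero]
    have hlen : ∀ l, l.length = k + 1 → f₁ l = 0 := fun l hl => by
      simp only [hf₁, hk l hl, d_eq_zero_of_length hsl l hl, sub_zero]
    -- Expanding both sides, `f₁ (x :: x :: l)` is exactly `d f (x :: x :: x :: l)`.
    have hrep : ∀ x l, runs (x :: l) < k + 2 → f₁ (x :: x :: l) = 0 := fun x l hl => by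
      have h₁ : d f (x :: x :: x :: l) = 0 :=
        hdf _ (by rwa [runs_cons_cons_self, runs_cons_cons_self])
      simp only [hf₁, d_cons, s] at h₁ ⊢
      rw [← h₁]
    have hhead : ∀ x l, runs (x :: l) < k + 2 → runs (x :: l) = runs l → f₁ (x :: l) = 0 := by
      intro x l hl hx
      by_cases h : l.head? = some x
      · obtain ⟨t, rfl⟩ := List.head?_eq_some_iff.1 h
        exact hrep x t (by rwa [runs_cons_cons_self] at hl)
      · rw [runs_cons_of_head_ne _ _ h] at hx
        omega
    -- With the first vertex `x` fixed and forming a run of its own, `f₁` is a cochain in the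
    -- remaining list, which has one run and one vertex fewer. The induction hypothesis applies to
    -- it.
    have key : ∀ x : Q, ∃ g : List Q → M, (∀ l, runs l < k → g l = 0) ∧
        ∀ l, runs l < k + 1 → (if runs (x :: l) = runs l then 0 else f₁ (x :: l)) - d g l = 0 := by
      intro x
      refine ih _ (fun l hl => ?_) (fun l hl => ?_) (fun l hl => ?_)
      · split_ifs with h
        · rfl
        · exact hfil _ ((runs_cons_le x l).trans_lt (by omega))
      · have hxl := runs_cons_le x l
        have h₁ := hdfil (x :: l) (by omega)
        rw [d_cons, hfil l hl, zero_sub, neg_eq_zero] at h₁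
        refine Eq.trans (d_congr fun l' hl' => ?_) h₁
        split_ifs with h
        · refine (hhead x l' ?_ h).symm
          have := runs_le_of_sublist (hl'.cons_cons x)
          omega
        · rfl
      · rw [hlen (x :: l) (by simp [hl]), ite_self]
    choose G hG hG' using key
    -- The sign compensates the one in `d_cons`, where the faces that keep the first vertex are
    -- subtracted.
    let g : List Q → M := fun l => match l with
      | [] => 0
      | x :: l => if runs (x :: l) = runs l then 0 else -G x l
    have hgfil : ∀ l, runs l < k + 1 → g l = 0 := by
      rintro (_ | ⟨x, l⟩) hl
      · rfl
      · change (if runs (x :: l) = runs l then 0 else -G x l) = 0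
        split_ifs with h
        · rfl
        · rw [hG x l, neg_zero]
          have := runs_le_cons x l
          omega
    refine ⟨fun l => g l + s l, fun l hl => ?_, fun l hl => ?_⟩
    · simp only [hgfil l hl, hs l hl, add_zero]
    · have h₁ : f l - (d g l + d s l) = f₁ l - d g l := by simp only [hf₁]; abel
      rw [d_add, h₁]
      rcases l with _ | ⟨x, l⟩
      · rw [d_nil, hfil _ (by simp [runs]), sub_zero]
      · by_cases h : l.head? = some x
        · obtain ⟨t, rfl⟩ := List.head?_eq_some_iff.1 h
          have hg₀ : ∀ l', g (x :: x :: l') = 0 := fun l' =>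
            if_pos (runs_cons_cons_self x l')
          rw [hrep x t (by rwa [runs_cons_cons_self] at hl), d_cons, d_cons]
          simp only [hg₀, d_zero]
          abel
        · have hx := runs_cons_of_head_ne _ _ h
          rw [d_cons, hgfil l (by omega)]
          -- The case distinction in `g` is invisible here. If a sublist `l'` starts with `x` while
          -- `l` does not, then `l'` has lost the first run of `l`, so it has fewer than `k` runs
          -- and `G x l'` is zero.
          have h₂ : d (fun l' => g (x :: l')) l = d (fun l' => -G x l') l := by
            refine d_congr fun l' hl' => ?_
            change (if runs (x :: l') = runs l' then 0 else -G x l') = _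
            split_ifs with h'
            · rw [hG x l', neg_zero]
              have hh : l'.head? = some x := by
                by_contra hne
                rw [runs_cons_of_head_ne _ _ hne] at h'
                omega
              obtain ⟨t', rfl⟩ := List.head?_eq_some_iff.1 hh
              rcases l with _ | ⟨y, t⟩
              · simp at hl'
              · have hxy : x ≠ y := fun e => h (by rw [e]; rfl)
                have h₃ : (x :: t').Sublist t := by
                  rcases List.sublist_cons_iff.1 hl' with h₃ | ⟨r, hr, -⟩
                  · exact h₃
                  · exact absurd (List.cons.inj hr).1 hxy
                have h₄ := runs_le_of_sublist (h₃.cons_cons y)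
                rw [runs_cons_of_head_ne y _ (by simpa using hxy)] at h₄
                omega
            · rfl
          have h₅ := hG' x l (by omega)
          rw [if_neg (by omega), sub_eq_zero] at h₅
          rw [h₂, d_neg, h₅]
          abel

end ListCochain

/-! ## Free group actions -/

/-- Functions on the generators of a free group that acts on `T` are coboundaries, in a way that is
compatible with the symmetries of the action, where the elements of `T` have an equivariant
coordinate in the free group. -/
theorem FreeGroup.exists_primitive {X T M : Type*} [AddCommGroup M]
    (act : FreeGroup X → T → T) (act_one : ∀ t, act 1 t = t)
    (act_mul : ∀ v w t, act (v * w) t = act v (act w t)) (pr : T → FreeGroup X)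
    (u : X → T → M) :
    ∃ g : T → M,
      (∀ x t, pr (act (of x) t) = of x * pr t → g (act (of x) t) = g t + u x t) ∧
      ∀ s : T → T, (∀ w t, act w (s t) = s (act w t)) → (∀ x t, u x (s t) = u x t) →
        (∀ t, pr (s t) = pr t) → ∀ t, g (s t) = g t := by
  have act_inv : ∀ w t, act w⁻¹ (act w t) = t := fun w t => by
    rw [← act_mul, inv_mul_cancel, act_one]
  have act_inv' : ∀ w t, act w (act w⁻¹ t) = t := fun w t => by
    rw [← act_mul, mul_inv_cancel, act_one]
  -- The skew product of the action with `u`. Freeness extends it from the generators to the whole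
  -- group, so `u` becomes a 1-cocycle without any relation to check.
  let gen : X → Equiv.Perm (T × M) := fun x =>
    { toFun := fun y => (act (of x) y.1, y.2 + u x y.1)
      invFun := fun y => (act (of x)⁻¹ y.1, y.2 - u x (act (of x)⁻¹ y.1))
      left_inv := fun y => by simp only [act_inv, add_sub_cancel_right]
      right_inv := fun y => by simp only [act_inv', sub_add_cancel] }
  let ρ := FreeGroup.lift gen
  have hρ : ∀ x, ρ (of x) = gen x := fun x => FreeGroup.lift_apply_of
  have hfst : ∀ w y, (ρ w y).1 = act w y.1 := by
    intro w
    induction w using FreeGroup.induction_on with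
    | C1 => intro y; rw [_root_.map_one, act_one]; rfl
    | of x => intro y; erw [hρ]; rfl
    | inv_of x _ => intro y; erw [_root_.map_inv, hρ]; rfl
    | mul v w hv hw => intro y; rw [_root_.map_mul, Equiv.Perm.mul_apply, hv, hw, act_mul]
  -- Start from the value 0 on the slice of points with trivial coordinate and transport along the
  -- group: `t` is reached from `act (pr t)⁻¹ t` by the word `pr t`.
  refine ⟨fun t => (ρ (pr t) (act (pr t)⁻¹ t, 0)).2, fun x t h => ?_, fun s hs hu hp => ?_⟩
  · have h₁ : act (of x * pr t)⁻¹ (act (of x) t) = act (pr t)⁻¹ t := by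
      rw [mul_inv_rev, act_mul, act_inv]
    simp only [h, h₁, _root_.map_mul, Equiv.Perm.mul_apply, hρ]
    change _ + u x (ρ (pr t) (act (pr t)⁻¹ t, 0)).1 = _
    rw [hfst, act_inv']
  · have hcomm : ∀ w y, ρ w (s y.1, y.2) = (s (ρ w y).1, (ρ w y).2) := by
      intro w
      induction w using FreeGroup.induction_on with
      | C1 => intro y; rw [_root_.map_one]; rfl
      | of x => intro y; erw [hρ]; exact Prod.ext (hs _ _) (by simp [gen, hu])
      | inv_of x _ =>
        intro y
        erw [_root_.map_inv, hρ]
        refine Prod.ext (hs _ _) ?_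
        change y.2 - u x (act (of x)⁻¹ (s y.1)) = y.2 - u x (act (of x)⁻¹ y.1)
        rw [hs, hu]
      | mul v w hv hw =>
        intro y
        rw [_root_.map_mul, Equiv.Perm.mul_apply, Equiv.Perm.mul_apply, hw]
        exact hv _
    intro t
    simp only [hp, hs]
    rw [hcomm (pr t) (act (pr t)⁻¹ t, 0)]

/-! ### Cohomology along the fibres: free group coordinates over a base -/

namespace ListCochain

variable {ι X Q M : Type*}

/-- The translation by `u` on the vertices. -/
def leftTranslate (u : ι → FreeGroup X) (v : (ι → FreeGroup X) × Q) : (ι → FreeGroup X) × Q :=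
  (u * v.1, v.2)

/-- The projection that makes the component `i` of a vertex trivial. -/
def collapse [DecidableEq ι] (i : ι) (v : (ι → FreeGroup X) × Q) : (ι → FreeGroup X) × Q :=
  (Function.update v.1 i 1, v.2)

lemma Fil.comp_of_over [AddCommGroup M] {V : Type*} {κ : V → Q} {k : ℕ} {f : List V → M} {φ : V → V}
    (hφ : ∀ x, κ (φ x) = κ x) (hf : Fil κ k f) : Fil κ k fun l => f (l.map φ) := by
  refine hf.comp fun l => ?_
  have : κ ∘ φ = κ := funext hφ
  rw [List.map_map, this]

lemma leftTranslate_comm (u u' : ι → FreeGroup X) (h : Commute u u') (v : (ι → FreeGroup X) × Q) :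
    leftTranslate u (leftTranslate u' v) = leftTranslate u' (leftTranslate u v) := by
  simp only [leftTranslate, ← mul_assoc, h.eq]

lemma leftTranslate_mul (u u' : ι → FreeGroup X) (v : (ι → FreeGroup X) × Q) :
    leftTranslate (u * u') v = leftTranslate u (leftTranslate u' v) := by
  simp only [leftTranslate, mul_assoc]

lemma leftTranslate_one (v : (ι → FreeGroup X) × Q) : leftTranslate 1 v = v := by
  simp only [leftTranslate, one_mul]

variable [DecidableEq ι]

lemma collapse_leftTranslate_single (i : ι) (w : FreeGroup X) (v : (ι → FreeGroup X) × Q) :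
    collapse i (leftTranslate (Pi.mulSingle i w) v) = collapse i v := by
  refine Prod.ext (funext fun j => ?_) rfl
  by_cases h : j = i
  · subst h; simp [collapse, leftTranslate]
  · simp [collapse, leftTranslate, h]

lemma collapse_leftTranslate_of_eq_one (i : ι) (u : ι → FreeGroup X) (hu : u i = 1)
    (v : (ι → FreeGroup X) × Q) :
    collapse i (leftTranslate u v) = leftTranslate u (collapse i v) := by
  refine Prod.ext (funext fun j => ?_) rfl
  by_cases h : j = i
  · subst h; simp [collapse, leftTranslate, hu]
  · simp [collapse, leftTranslate, h]

lemma collapse_collapse (i : ι) (v : (ι → FreeGroup X) × Q) :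
    collapse i (collapse i v) = collapse i v := by
  simp [collapse]

lemma collapse_comm (i j : ι) (v : (ι → FreeGroup X) × Q) :
    collapse i (collapse j v) = collapse j (collapse i v) := by
  by_cases h : i = j
  · rw [h]
  · simp [collapse, Function.update_comm h]

/-- A cochain that is invariant under the generators of the component `i` and under the other
components is invariant. -/
lemma invariant_of_generators {N : Type*} (i : ι) {f : List ((ι → FreeGroup X) × Q) → N}
    (h₁ : ∀ x l, f (l.map (leftTranslate (Pi.mulSingle i (FreeGroup.of x)))) = f l)
    (h₂ : ∀ u : ι → FreeGroup X, u i = 1 → ∀ l, f (List.map (leftTranslate u) l) = f l)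
    (u : ι → FreeGroup X) (l : List ((ι → FreeGroup X) × Q)) :
    f (l.map (leftTranslate u)) = f l := by
  have hmul : ∀ (u u' : ι → FreeGroup X) (l : List ((ι → FreeGroup X) × Q)),
      l.map (leftTranslate (u * u')) = (l.map (leftTranslate u')).map (leftTranslate u) := fun u u' l => by
    rw [List.map_map]
    exact List.map_congr_left fun v _ => leftTranslate_mul u u' v
  have hone : ∀ l : List ((ι → FreeGroup X) × Q), l.map (leftTranslate 1) = l := fun l => by
    conv_rhs => rw [← List.map_id l]
    exact List.map_congr_left fun v _ => leftTranslate_one v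
  have h₃ : ∀ (w : FreeGroup X) l, f (l.map (leftTranslate (Pi.mulSingle i w))) = f l := by
    intro w
    induction w using FreeGroup.induction_on with
    | C1 => intro l; rw [Pi.mulSingle_one, hone]
    | of x => exact h₁ x
    | inv_of x h =>
      intro l
      rw [← h (l.map _), ← hmul, ← Pi.mulSingle_mul]
      erw [mul_inv_cancel]
      rw [Pi.mulSingle_one, hone]
    | mul v w hv hw => intro l; rw [Pi.mulSingle_mul, hmul, hv, hw]
  have h : u = Pi.mulSingle i (u i) * Function.update u i 1 := by
    funext j
    by_cases hj : j = i
    · subst hj; simp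
    · simp [hj]
  rw [h, hmul, h₃, h₂ _ (by simp)]

variable [AddCommGroup M]

/-- Collapsing all components shows that `f` depends only on the images of the vertices in `Q`. A
primitive pulled back from `Q` is automatically invariant under translations. -/
lemma exists_fil_sub_d_of_collapse_eq [Fintype ι] (k : ℕ)
    (f : List ((ι → FreeGroup X) × Q) → M) (hf : Fil Prod.snd k f)
    (hdf : Fil Prod.snd (k + 1) (d f)) (hc : ∀ i l, f (List.map (collapse i) l) = f l)
    (hl : ∀ l, l.length = k → f l = 0) :
    ∃ g : List ((ι → FreeGroup X) × Q) → M, Fil Prod.snd k g ∧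
      (∀ u l, g (List.map (leftTranslate u) l) = g l) ∧ Fil Prod.snd (k + 1) fun l => f l - d g l := by
  have h₁ : ∀ (T : Finset ι) l, f (l.map fun v => (fun j => if j ∈ T then 1 else v.1 j, v.2)) =
      f l := by
    intro T
    induction T using Finset.induction_on with
    | empty => intro l; simp
    | insert i T _ ih =>
      intro l
      rw [← (ih (l.map (collapse i))).trans (hc i l), List.map_map]
      congr 2
      funext v
      refine Prod.ext (funext fun j => ?_) rfl
      by_cases hj : j = i
      · subst hj; simp [collapse]
      · simp [collapse, hj]
  let j : Q → (ι → FreeGroup X) × Q := fun φ => (1, φ)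
  have hj : ∀ l : List Q, (l.map j).map Prod.snd = l := fun l => by
    rw [List.map_map]; exact List.map_id l
  have hfj : ∀ l, f l = f ((l.map Prod.snd).map j) := fun l => by
    rw [← h₁ Finset.univ l, List.map_map]
    congr 2
    funext v
    exact Prod.ext (funext fun j => by simp; rfl) rfl
  obtain ⟨g, hg, hg'⟩ := exists_fil_sub_d k (fun l => f (l.map j))
    (fun l h => hf _ (by rwa [hj, ← List.map_id l]))
    (fun l h => by rw [d_map]; exact hdf _ (by rwa [hj, ← List.map_id l]))
    (fun l h => hl _ (by simpa using h))
  refine ⟨fun l => g (l.map Prod.snd), fun l h => hg _ (by rwa [List.map_id]), fun u l => ?_,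
    fun l h => ?_⟩
  · simp only [List.map_map]; rfl
  · change f l - d (fun l => g (l.map Prod.snd)) l = 0
    rw [d_map, hfj]
    exact hg' _ (by rwa [List.map_id])

/-- The cochains on the lists in `(ι → F) × Q` with exactly `k` runs in `Q` that are invariant under
`ι → F`, reduced in the components in `S`, and independent of the other components only have
cohomology in length `k + #S`. -/
theorem exists_fil_sub_d_of_reduced [Fintype ι] (k : ℕ) (hk : 1 ≤ k) (S : Finset ι)
    (f : List ((ι → FreeGroup X) × Q) → M) (hf : Fil Prod.snd k f)
    (hdf : Fil Prod.snd (k + 1) (d f)) (hu : ∀ u l, f (List.map (leftTranslate u) l) = f l)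
    (hS : ∀ i ∈ S, ∀ l, f (List.map (collapse i) l) = 0)
    (hS' : ∀ i ∉ S, ∀ l, f (List.map (collapse i) l) = f l)
    (hl : ∀ l, l.length = k + S.card → f l = 0) :
    ∃ g : List ((ι → FreeGroup X) × Q) → M, Fil Prod.snd k g ∧
      (∀ u l, g (List.map (leftTranslate u) l) = g l) ∧ Fil Prod.snd (k + 1) fun l => f l - d g l := by
  induction S using Finset.induction_on generalizing f with
  | empty => exact exists_fil_sub_d_of_collapse_eq k f hf hdf (fun i => hS' i (by simp)) hl
  | insert i S hi ih =>
    have mm : ∀ {φ ψ : (ι → FreeGroup X) × Q → (ι → FreeGroup X) × Q}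
        (_ : ∀ v, φ (ψ v) = ψ (φ v)) (l : List ((ι → FreeGroup X) × Q)),
        (l.map ψ).map φ = (l.map φ).map ψ := fun h l => by
      rw [List.map_map, List.map_map]
      exact List.map_congr_left fun v _ => h v
    have hover : ∀ v : (ι → FreeGroup X) × Q, (collapse i v).2 = v.2 := fun _ => rfl
    have hsingle : ∀ (x : X) (u : ι → FreeGroup X), u i = 1 →
        Commute u (Pi.mulSingle i (FreeGroup.of x)) := fun x u hui => by
      funext j
      by_cases hj : j = i
      · subst hj; simp [hui]
      · simp [hj]
    -- a primitive of `f` that is only invariant under the other components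
    set g : List ((ι → FreeGroup X) × Q) → M := fun l => -prism (collapse i) f l with hgdef
    have hg : Fil Prod.snd k g := (hf.prism hover).neg
    have hfg : Fil Prod.snd (k + 1) fun l => f l - d g l := fun l hl => by
      have h₁ := d_prism_add_prism_d (collapse i) f l
      rw [hS i (by simp), hdf.prism hover l hl, add_zero, zero_sub] at h₁
      change f l - d g l = 0
      rw [hgdef, d_neg, h₁, neg_neg, sub_self]
    have hgu : ∀ u : ι → FreeGroup X, u i = 1 → ∀ l, g (List.map (leftTranslate u) l) = g l := by
      intro u hui l
      simp only [hgdef]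
      rw [← prism_map fun v => (collapse_leftTranslate_of_eq_one i u hui v).symm]
      simp only [hu]
    have hgS : ∀ j ∈ S, ∀ l, g (List.map (collapse j) l) = 0 := by
      intro j hj l
      simp only [hgdef]
      rw [← prism_map fun v => collapse_comm j i v]
      simp only [hS j (by simp [hj])]
      rw [prism_zero, neg_zero]
    have hgS' : ∀ j ∉ insert i S, ∀ l, g (List.map (collapse j) l) = g l := by
      intro j hj l
      simp only [hgdef]
      rw [← prism_map fun v => collapse_comm j i v]
      simp only [hS' j hj]
    -- The prism evaluates `f` on lists with one more vertex, so the excluded length drops by one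
    -- together with the cardinality.
    have hgl : ∀ l, l.length = k + S.card → g l = 0 := by
      intro l h
      simp only [hgdef]
      rw [prism_eq_zero, neg_zero]
      rintro p x t rfl
      refine hl _ ?_
      simp only [List.length_append, List.length_cons, List.length_map,
        Finset.card_insert_of_notMem hi] at h ⊢
      omega
    -- the defect of invariance under the generators of the component `i`
    let c : X → List ((ι → FreeGroup X) × Q) → M := fun x l =>
      g (l.map (leftTranslate (Pi.mulSingle i (FreeGroup.of x)))) - g l
    have hc : ∀ x, Fil Prod.snd k (c x) := fun x => (hg.comp_of_over (φ := leftTranslate _) fun _ => rfl).sub hg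
    have hdc : ∀ x, Fil Prod.snd (k + 1) (d (c x)) := by
      intro x l h
      have h₁ := hfg l h
      have h₂ := hfg (l.map (leftTranslate (Pi.mulSingle i (FreeGroup.of x))))
        (by rw [List.map_map]; exact h)
      simp only [c]
      rw [d_sub, d_map, ← sub_eq_zero.1 h₁, ← sub_eq_zero.1 h₂, hu, sub_self]
    -- After collapsing the component `i`, the defect is invariant under every component, reduced in
    -- `S` and independent of the rest, so it is covered by the induction hypothesis for `S`.
    have hcc : ∀ x, ∃ b : List ((ι → FreeGroup X) × Q) → M, Fil Prod.snd k b ∧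
        (∀ u l, b (List.map (leftTranslate u) l) = b l) ∧
        Fil Prod.snd (k + 1) fun l => c x (l.map (collapse i)) - d b l := by
      intro x
      refine ih (fun l => c x (l.map (collapse i))) ((hc x).comp_of_over hover) ?_ ?_ ?_ ?_ ?_
      · rw [show d (fun l => c x (l.map (collapse i))) = fun l => d (c x) (l.map (collapse i))
          from funext (d_map _ _)]
        exact (hdc x).comp_of_over hover
      · refine invariant_of_generators (f := fun l => c x (List.map (collapse i) l)) i
          (fun y l => ?_) fun u hui l => ?_
        · simp only [List.map_map]
          congr 2
          exact funext (collapse_leftTranslate_single i _)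
        · simp only [c]
          rw [mm (fun v => collapse_leftTranslate_of_eq_one i u hui v),
            mm (fun v => leftTranslate_comm _ u (hsingle x u hui).symm v), hgu u hui, hgu u hui]
      · intro j hj l
        have hji : j ≠ i := fun e => hi (e ▸ hj)
        simp only [c]
        rw [mm (fun v => collapse_comm i j v), hgS j hj,
          mm (fun v => (collapse_leftTranslate_of_eq_one j _ (by simp [hji]) v).symm), hgS j hj,
          sub_zero]
      · intro j hj l
        by_cases hji : j = i
        · subst hji
          simp only [List.map_map]
          congr 2
          exact funext (collapse_collapse j)
        · have hj' : j ∉ insert i S := by simp [hji, hj]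
          simp only [c]
          rw [mm (fun v => collapse_comm i j v), hgS' j hj',
            mm (fun v => (collapse_leftTranslate_of_eq_one j _ (by simp [hji]) v).symm), hgS' j hj']
      · intro l h
        simp only [c]
        rw [hgl _ (by simpa using h), hgl _ (by simpa using h), sub_zero]
    choose b hb hbu hcb using hcc
    -- the defect is the coboundary of `u`
    let u : X → List ((ι → FreeGroup X) × Q) → M := fun x l => b x l - prism (collapse i) (c x) l
    have huFil : ∀ x, Fil Prod.snd k (u x) := fun x => (hb x).sub ((hc x).prism hover)
    -- The prism homotopy joins `c x` to its collapse, whose primitive is `b x`.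
    have hcu : ∀ x, Fil Prod.snd (k + 1) fun l => c x l - d (u x) l := by
      intro x l h
      have h₁ := d_prism_add_prism_d (collapse i) (c x) l
      rw [(hdc x).prism hover l h, add_zero] at h₁
      have h₂ : c x (l.map (collapse i)) - d (b x) l = 0 := hcb x l h
      simp only [u]
      rw [d_sub, h₁, ← h₂]
      abel
    have huu : ∀ x (w : ι → FreeGroup X), w i = 1 → ∀ l, u x (List.map (leftTranslate w) l) = u x l := by
      intro x w hw l
      simp only [u]
      rw [hbu, ← prism_map fun v => (collapse_leftTranslate_of_eq_one i w hw v).symm]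
      have : ∀ l, c x (List.map (leftTranslate w) l) = c x l := fun l => by
        simp only [c]
        rw [mm (fun v => leftTranslate_comm _ w (hsingle x w hw).symm v), hgu w hw, hgu w hw]
      simp only [this]
    -- The free group acts on lists by translating the component `i`, and its equivariant coordinate
    -- is the component `i` of the first vertex. The empty list gets the default 1, which is not
    -- equivariant.
    obtain ⟨g', hg', hg''⟩ := FreeGroup.exists_primitive
      (fun w l => l.map (leftTranslate (Pi.mulSingle i w)))
      (fun l => by
        rw [Pi.mulSingle_one]
        conv_rhs => rw [← List.map_id l]
        exact List.map_congr_left fun v _ => leftTranslate_one v)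
      (fun w w' l => by
        rw [Pi.mulSingle_mul, List.map_map]
        exact List.map_congr_left fun v _ => leftTranslate_mul _ _ v)
      (fun l : List ((ι → FreeGroup X) × Q) => (l.head?.map fun v => v.1 i).getD 1) u
    have hsnd : ∀ (w : ι → FreeGroup X) (l : List ((ι → FreeGroup X) × Q)),
        (l.map (leftTranslate w)).map Prod.snd = l.map Prod.snd := fun w l => by
      rw [List.map_map]; rfl
    -- The cutoff puts `g₁` into the filtration. As `1 ≤ k`, it also discards the empty list, the
    -- only one where the coordinate is not equivariant.
    let g₁ : List ((ι → FreeGroup X) × Q) → M := fun l =>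
      if runs (l.map Prod.snd) < k then 0 else g' l
    have hg₁ : Fil Prod.snd k g₁ := fun l h => if_pos h
    have hg₁x : ∀ x l, g₁ (List.map (leftTranslate (Pi.mulSingle i (FreeGroup.of x))) l) =
        g₁ l + u x l := by
      intro x l
      simp only [g₁, hsnd]
      split_ifs with h
      · rw [huFil x l h, add_zero]
      · refine hg' x l ?_
        rcases l with _ | ⟨v, l⟩
        · exact absurd hk (by simpa [runs] using h)
        · simp [leftTranslate]
    have hg₁u : ∀ w : ι → FreeGroup X, w i = 1 → ∀ l, g₁ (List.map (leftTranslate w) l) = g₁ l := by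
      intro w hw l
      simp only [g₁, hsnd]
      split_ifs with h
      · rfl
      · refine hg'' (fun l => l.map (leftTranslate w)) (fun v l => ?_) (fun x l => huu x w hw l)
          (fun l => ?_) l
        · refine mm (fun v => leftTranslate_comm _ w ?_ v) l
          funext j
          by_cases hj : j = i
          · subst hj; simp [hw]
          · simp [hj]
        · cases l <;> simp [leftTranslate, hw]
    -- The coboundary leaves `d g` unchanged and cancels the defect of invariance, since `c x` is `d
    -- (u x)` on lists with at most `k` runs.
    let g₂ : List ((ι → FreeGroup X) × Q) → M := fun l => g l - d g₁ l
    have hg₂ : Fil Prod.snd k g₂ := hg.sub hg₁.d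
    -- So far invariance is known only on lists with at most `k` runs; cutting off makes it exact.
    -- On such lists `d` sees only sublists, which again have at most `k` runs.
    let g₃ : List ((ι → FreeGroup X) × Q) → M := fun l =>
      if runs (l.map Prod.snd) < k + 1 then g₂ l else 0
    refine ⟨g₃, fun l h => ?_, invariant_of_generators i (fun x l => ?_) fun w hw l => ?_,
      fun l h => ?_⟩
    · simp only [g₃, hg₂ l h, ite_self]
    · simp only [g₃, hsnd]
      split_ifs with h
      · have h₁ : c x l - d (u x) l = 0 := hcu x l h
        simp only [g₂]
        rw [← d_map, show (fun l => g₁ (List.map (leftTranslate (Pi.mulSingle i (FreeGroup.of x))) l)) =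
          fun l => g₁ l + u x l from funext (hg₁x x), d_add, ← sub_eq_zero.1 h₁]
        simp only [c]
        abel
      · rfl
    · simp only [g₃, hsnd]
      split_ifs with h
      · simp only [g₂]
        rw [← d_map, hgu w hw, show (fun l => g₁ (List.map (leftTranslate w) l)) = g₁
          from funext (hg₁u w hw)]
      · rfl
    · have h₁ : d g₃ l = d g₂ l := d_congr fun l' hl' =>
        if_pos ((runs_le_of_sublist (hl'.map _)).trans_lt h)
      change f l - d g₃ l = 0
      simp only [h₁, g₂]
      rw [d_sub, d_d, sub_zero]
      exact hfg l h

end ListCochain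

/-! ## Homogeneous coordinates on the nerve of a group -/

namespace GroupNerve

variable {G H : Type} [Group G] [Group H]

/-- The simplex of the nerve of a group with homogeneous coordinates `b`: the arrow from `i` to `j`
is `(b j)⁻¹ * b i`. -/
def simplex {m : ℕ} (b : Fin (m + 1) → G) : (nerve (SingleObj G)).obj (op ⦋m⦌) :=
  show ComposableArrows (SingleObj G) m from
  { obj := fun _ => SingleObj.star G
    map := fun {i j} _ => ((b j)⁻¹ * b i : G)
    map_id := fun i => inv_mul_cancel (b i)
    map_comp := fun {i j k} _ _ => by
      rw [SingleObj.comp_as_mul]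
      group }

lemma simplex_mul_left {m : ℕ} (g : G) (b : Fin (m + 1) → G) :
    simplex (fun i => g * b i) = simplex b := by
  refine CategoryTheory.Functor.hext (fun _ => rfl) fun i j _ => heq_of_eq ?_
  change (g * b j)⁻¹ * (g * b i) = (b j)⁻¹ * b i
  group

lemma nerveMap_simplex {m : ℕ} (f : G →* H) (b : Fin (m + 1) → G) :
    (nerveMap f.toFunctor).app (op ⦋m⦌) (simplex b) = simplex (f ∘ b) := by
  refine CategoryTheory.Functor.hext (fun _ => rfl) fun i j _ => heq_of_eq ?_
  change f ((b j)⁻¹ * b i) = (f (b j))⁻¹ * f (b i)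
  rw [map_mul, map_inv]

lemma exists_simplex_eq {m : ℕ} (σ : (nerve (SingleObj G)).obj (op ⦋m⦌)) :
    ∃ b : Fin (m + 1) → G, b 0 = 1 ∧ simplex b = σ := by
  let s : ComposableArrows (SingleObj G) m := σ
  let a : ∀ i : Fin (m + 1), G := fun i => s.map (homOfLE (Fin.zero_le i))
  refine ⟨fun i => (a i)⁻¹, ?_, ?_⟩
  · have : a 0 = 1 := s.map_id 0
    exact inv_eq_one.2 this
  · refine CategoryTheory.Functor.hext (fun _ => rfl) fun i j f => heq_of_eq ?_
    change (a j)⁻¹⁻¹ * (a i)⁻¹ = s.map f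
    have h : a j = (show G from s.map f) * a i := by
      change s.map _ = s.map _ ≫ s.map _
      rw [← s.map_comp]
      rfl
    rw [h, inv_inv, mul_inv_cancel_right]

lemma simplex_eq_iff {m : ℕ} (b b' : Fin (m + 1) → G) (h : simplex b = simplex b') :
    ∃ g : G, ∀ i, b' i = g * b i := by
  refine ⟨b' 0 * (b 0)⁻¹, fun i => ?_⟩
  have h₁ : ∀ i, (b i)⁻¹ * b 0 = (b' i)⁻¹ * b' 0 := fun i =>
    eq_of_heq (congr_arg_heq (fun s : ComposableArrows (SingleObj G) m =>
      s.map (homOfLE (Fin.zero_le i))) h)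
  have h₂ := h₁ i
  rw [← mul_right_inj (b' i), mul_inv_cancel_left] at h₂
  rw [← h₂]
  group

end GroupNerve

/-! ### The skeleton of the nerve of a group -/

/-- A monotone sequence never returns to a value it has left, so its runs correspond to distinct
elements of `Fin (k + 1)`. The induction carries the bound: number of runs plus first value at most
`k + 1`. -/
lemma runs_map_ofFn_le {Q : Type*} {m k : ℕ} (θ : Fin (m + 1) →o Fin (k + 1))
    (ψ : Fin (k + 1) → Q) : runs (List.ofFn (ψ ∘ θ)) ≤ k + 1 := by
  have h₁ : ∀ (l : List (Fin (k + 1))) (x : Fin (k + 1)), (x :: l).Pairwise (· ≤ ·) →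
      runs (x :: l) + x ≤ k + 1 := by
    intro l
    induction l with
    | nil =>
      intro x _
      simp only [runs, List.head?_nil]
      simp
      omega
    | cons y l ih =>
      intro x h
      have hxy : x ≤ y := (List.pairwise_cons.1 h).1 y (by simp)
      have h₂ := ih y (List.pairwise_cons.1 h).2
      by_cases e : x = y
      · subst e
        rwa [runs_cons_cons_self]
      · rw [runs_cons_of_head_ne _ _ (by simpa using fun e' => e e'.symm)]
        have : (x : ℕ) < y := lt_of_le_of_ne hxy fun e' => e (Fin.ext e')
        omega
  rw [← List.map_ofFn]
  refine (runs_map_le ψ _).trans ?_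
  have h₂ : (List.ofFn θ).Pairwise (· ≤ ·) := by
    rw [List.pairwise_ofFn]
    exact fun i j hij => θ.monotone hij.le
  rw [List.ofFn_succ] at h₂ ⊢
  exact (Nat.le_add_right _ _).trans (h₁ _ _ h₂)

/-- Contracting each run to a point gives a degeneracy `θ`; `θ 0 = 0` is recorded so that a vertex
can be prepended in the induction. -/
lemma exists_factor_of_runs {Q : Type*} (m : ℕ) (φ : Fin (m + 1) → Q) :
    ∃ (k : ℕ) (θ : Fin (m + 1) →o Fin (k + 1)) (ψ : Fin (k + 1) → Q),
      runs (List.ofFn φ) = k + 1 ∧ θ 0 = 0 ∧ φ = ψ ∘ θ := by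
  induction m with
  | zero =>
    refine ⟨0, OrderHom.id, φ, ?_, rfl, rfl⟩
    simp [runs]
  | succ m ih =>
    obtain ⟨k, θ, ψ, hk, h₀, h⟩ := ih fun i => φ i.succ
    have hψ : φ 1 = ψ 0 := by simpa [h₀] using congrFun h 0
    by_cases e : φ 1 = φ 0
    · refine ⟨k, ⟨Fin.cons 0 θ, ?_⟩, ψ, ?_, rfl, ?_⟩
      · intro i j hij
        induction i using Fin.cases with
        | zero => exact Fin.zero_le _
        | succ i =>
          induction j using Fin.cases with
          | zero => exact absurd hij (by simp)
          | succ j => exact θ.monotone (by simpa using hij)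
      · rw [List.ofFn_succ, runs_cons_of_head _ _ (by simpa [List.ofFn_succ] using e), hk]
      · funext i
        induction i using Fin.cases with
        | zero => exact e.symm.trans hψ
        | succ i => exact congrFun h i
    · refine ⟨k + 1, ⟨Fin.cons 0 fun i => (θ i).succ, ?_⟩, Fin.cons (φ 0) ψ, ?_, rfl, ?_⟩
      · intro i j hij
        induction i using Fin.cases with
        | zero => exact Fin.zero_le _
        | succ i =>
          induction j using Fin.cases with
          | zero => exact absurd hij (by simp)
          | succ j => exact Fin.succ_le_succ_iff.2 (θ.monotone (by simpa using hij))
      · rw [List.ofFn_succ, runs_cons_of_head_ne _ _ (by simpa [List.ofFn_succ] using e), hk]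
      · funext i
        induction i using Fin.cases with
        | zero => rfl
        | succ i => exact congrFun h i

/-- A simplex is degenerate along the runs of its vertices: it comes from a simplex of dimension one
less than the number of runs. The skeleton with index `a` is generated in dimensions below `a`,
hence the bound `≤ a`. For the forward direction, a section of the degeneracy puts the nondegenerate
simplex into the skeleton too. -/
lemma GroupNerve.simplex_mem_skeleton_iff {G : Type} [Group G] {m : ℕ} (a : ℕ)
    (b : Fin (m + 1) → G) :
    simplex b ∈ ((nerve (SingleObj G)).skeleton a).obj (op ⦋m⦌) ↔ runs (List.ofFn b) ≤ a := by
  constructor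
  · intro h
    obtain ⟨k, f, hf, y, hy⟩ := (nerve (SingleObj G)).exists_nonDegenerate (simplex b)
    have : IsSplitEpi f := isSplitEpi_of_epi f
    have hs : section_ f ≫ f = 𝟙 _ := IsSplitEpi.id f
    have hy' : (nerve (SingleObj G)).map (section_ f).op (simplex b) = y.1 := by
      rw [hy, ← Functor.map_comp_apply, ← op_comp, hs, op_id, Functor.map_id_apply]
    have hk : k < a := by
      rw [← SSet.mem_skeleton_obj_iff_of_nonDegenerate _ y, ← hy']
      exact ((nerve (SingleObj G)).skeleton a).map (section_ f).op h
    obtain ⟨c, -, hc⟩ := exists_simplex_eq y.1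
    rw [← hc] at hy
    have h₁ : simplex (c ∘ f.toOrderHom) = simplex b := hy.symm
    obtain ⟨g, hg⟩ := simplex_eq_iff _ _ h₁
    have h₂ : b = (fun x => g * x) ∘ (c ∘ f.toOrderHom) := funext hg
    rw [h₂, ← List.map_ofFn, runs_map_of_injective _ (mul_right_injective g)]
    exact (runs_map_ofFn_le _ _).trans hk
  · intro h
    obtain ⟨k, θ, ψ, hk, -, rfl⟩ := exists_factor_of_runs m b
    have h₁ : simplex ψ ∈ ((nerve (SingleObj G)).skeleton a).obj (op ⦋k⦌) :=
      SSet.mem_skeleton _ _ (by omega)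
    exact ((nerve (SingleObj G)).skeleton a).map (show ⦋m⦌ ⟶ ⦋k⦌ from SimplexCategory.Hom.mk θ).op h₁

/-! ### The differential and the Serre filtration in homogeneous coordinates -/

lemma ListCochain.d_ofFn {V M : Type*} [AddCommGroup M] {m : ℕ} (f : List V → M)
    (b : Fin (m + 1) → V) :
    d f (List.ofFn b) = ∑ i : Fin (m + 1), (-1 : ℤ) ^ (i : ℕ) • f (List.ofFn (b ∘ i.succAbove)) := by
  induction m generalizing f with
  | zero => simp [d_cons, d_nil]
  | succ m ih =>
    rw [List.ofFn_succ, d_cons, ih, Fin.sum_univ_succ (n := m + 1), sub_eq_add_neg, ← Finset.sum_neg_distrib]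
    congr 1
    · simp [Function.comp_def]
    · refine Finset.sum_congr rfl fun i _ => ?_
      rw [Fin.val_succ, pow_succ, mul_neg_one, neg_smul]
      congr 3
      rw [List.ofFn_succ]
      simp [Function.comp_def]

lemma objD_apply (X : CosimplicialObject (ModuleCat.{v} ℚ)) (m : ℕ) (c : X.obj ⦋m⦌) :
    (AlgebraicTopology.AlternatingCofaceMapComplex.objD X m).hom c =
      ∑ i : Fin (m + 2), (-1 : ℤ) ^ (i : ℕ) • (X.δ i).hom c := by
  rw [AlgebraicTopology.AlternatingCofaceMapComplex.objD, ModuleCat.hom_sum, LinearMap.sum_apply]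
  rfl

namespace GroupNerve

variable {G Q : Type} [Group G] [Group Q] (π : G →* Q)
  (Φ : SingleObj Q ⥤ ModuleCat.{v} ℚ)

/-- The pullback to the nerve of `G` of the local system on the nerve of `Q` given by `Φ`. -/
abbrev system : LocalSystem.{v} (nerve (SingleObj G)) :=
  LocalSystem.pullback (nerveMap π.toFunctor) (LocalSystem.ofFunctor Φ)

/-- The vector space of a functor on a group. -/
abbrev space : Type v := Φ.obj (SingleObj.star Q)

/-- The action of the group on the vector space of a functor. -/
def action (φ : Q) : space Φ →ₗ[ℚ] space Φ :=
  (Φ.map (show SingleObj.star Q ⟶ SingleObj.star Q from φ)).hom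

lemma action_one (x : space Φ) : action Φ 1 x = x := by
  have h := Φ.map_id (SingleObj.star Q)
  change (Φ.map (𝟙 (SingleObj.star Q))).hom x = x
  rw [h]
  rfl

lemma action_mul (φ ψ : Q) (x : space Φ) : action Φ (φ * ψ) x = action Φ φ (action Φ ψ x) := by
  have h := Φ.map_comp (show SingleObj.star Q ⟶ SingleObj.star Q from ψ)
    (show SingleObj.star Q ⟶ SingleObj.star Q from φ)
  change (Φ.map ((show SingleObj.star Q ⟶ SingleObj.star Q from ψ) ≫
    (show SingleObj.star Q ⟶ SingleObj.star Q from φ))).hom x = _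
  rw [h]
  rfl

variable {m : ℕ}

/-- The value of a cochain on a simplex, as an element of a fixed vector space. -/
def value (c : (system π Φ).cochains.X m) (σ : (nerve (SingleObj G)).obj (op ⦋m⦌)) : space Φ :=
  (show ∀ σ : (nerve (SingleObj G)).obj (op ⦋m⦌), (system π Φ).stalk σ from c) σ

/-- A cochain in homogeneous coordinates. -/
def coord (c : (system π Φ).cochains.X m) (b : Fin (m + 1) → G) : space Φ :=
  action Φ (π (b (Fin.last m))) (value π Φ c (simplex b))

/-- The cochain with given values. -/
def ofValues (f : (nerve (SingleObj G)).obj (op ⦋m⦌) → space Φ) : (system π Φ).cochains.X m :=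
  show ∀ σ : (nerve (SingleObj G)).obj (op ⦋m⦌), (system π Φ).stalk σ from f

lemma value_ofValues (f : (nerve (SingleObj G)).obj (op ⦋m⦌) → space Φ) :
    value π Φ (ofValues π Φ f) = f :=
  rfl

lemma coord_sub (c c' : (system π Φ).cochains.X m) (b : Fin (m + 1) → G) :
    coord π Φ (c - c') b = coord π Φ c b - coord π Φ c' b :=
  (action Φ _).map_sub _ _

lemma action_injective (φ : Q) : Function.Injective (action Φ φ) := fun x y h => by
  rw [← action_one Φ x, ← action_one Φ y, ← inv_mul_cancel φ, action_mul, action_mul, h]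

lemma coord_injective {c c' : (system π Φ).cochains.X m} (h : coord π Φ c = coord π Φ c') :
    c = c' := by
  refine funext fun σ => ?_
  obtain ⟨b, -, rfl⟩ := exists_simplex_eq σ
  exact action_injective Φ _ (congrFun h b)

lemma coord_mul_left (c : (system π Φ).cochains.X m) (g : G) (b : Fin (m + 1) → G) :
    coord π Φ c (fun i => g * b i) = action Φ (π g) (coord π Φ c b) := by
  rw [coord, coord, simplex_mul_left, map_mul, action_mul]

/-- An equivariant function of the homogeneous coordinates comes from a cochain. -/
lemma exists_coord_eq (f : (Fin (m + 1) → G) → space Φ)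
    (hf : ∀ g b, f (fun i => g * b i) = action Φ (π g) (f b)) :
    ∃ c, coord π Φ c = f := by
  choose β _ hβ' using fun σ : (nerve (SingleObj G)).obj (op ⦋m⦌) => exists_simplex_eq σ
  refine ⟨ofValues π Φ fun σ => action Φ (π (β σ (Fin.last m)))⁻¹ (f (β σ)), funext fun b => ?_⟩
  rw [coord, value_ofValues, ← action_mul]
  obtain ⟨g, hg⟩ := simplex_eq_iff _ _ (hβ' (simplex b))
  conv_rhs => rw [funext hg, hf]
  congr 2
  rw [hg (Fin.last m), map_mul, mul_inv_cancel_right]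

lemma mem_filtration_iff (a : ℤ) (c : (system π Φ).cochains.X m) :
    c ∈ Serre.filtration (nerveMap π.toFunctor) (system π Φ) a m ↔
      ∀ b : Fin (m + 1) → G, runs (List.ofFn (π ∘ b)) ≤ a.toNat → coord π Φ c b = 0 := by
  constructor
  · intro h b hb
    have h₁ : value π Φ c (simplex b) = 0 := by
      refine h (simplex b) ?_
      rw [nerveMap_simplex]
      exact (simplex_mem_skeleton_iff _ _).2 hb
    rw [coord, h₁, map_zero]
  · intro h σ hσ
    obtain ⟨b, -, rfl⟩ := exists_simplex_eq σ
    rw [nerveMap_simplex] at hσ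
    refine action_injective Φ (π (b (Fin.last m))) ?_
    exact (h b ((simplex_mem_skeleton_iff _ _).1 hσ)).trans (map_zero _).symm

/-- The local system is evaluated at the last vertex, so a face contributes the arrow from its own
last vertex to that of the simplex. -/
lemma value_δ (c : (system π Φ).cochains.X m) (b : Fin (m + 2) → G) (i : Fin (m + 2)) :
    value π Φ (((system π Φ).cosimplicial.δ i).hom c) (simplex b) =
      action Φ ((π (b (Fin.last (m + 1))))⁻¹ * π (b (i.succAbove (Fin.last m))))
        (value π Φ c (simplex (b ∘ i.succAbove))) := by
  rw [← map_inv, ← map_mul]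
  change (Φ.map (eqToHom _ ≫ _)).hom _ = _
  rw [eqToHom_refl, Category.id_comp]
  rfl

/-- The factor `π (b (Fin.last m))` in `coord` moves all values to a common stalk and absorbs the
transport in `value_δ`. -/
lemma coord_d (c : (system π Φ).cochains.X m) (b : Fin (m + 2) → G) :
    coord π Φ (((system π Φ).cochains.d m (m + 1)).hom c) b =
      ∑ i : Fin (m + 2), (-1 : ℤ) ^ (i : ℕ) • coord π Φ c (b ∘ i.succAbove) := by
  have h₁ : (system π Φ).cochains.d m (m + 1) =
      AlgebraicTopology.AlternatingCofaceMapComplex.objD (system π Φ).cosimplicial m :=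
    CochainComplex.of_d _ (AlgebraicTopology.AlternatingCofaceMapComplex.objD _) m
  have h₂ : value π Φ (((system π Φ).cochains.d m (m + 1)).hom c) (simplex b) =
      ∑ i : Fin (m + 2), (-1 : ℤ) ^ (i : ℕ) •
        value π Φ (((system π Φ).cosimplicial.δ i).hom c) (simplex b) := by
    have h₃ := objD_apply (system π Φ).cosimplicial m c
    exact (congrFun ((congrArg (fun f => f.hom c) h₁).trans h₃) (simplex b)).trans (Finset.sum_apply (simplex b) _ _)
  rw [coord, h₂, map_sum]
  refine Finset.sum_congr rfl fun i _ => ?_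
  rw [map_zsmul, value_δ, ← action_mul, mul_inv_cancel_left]
  rfl

end GroupNerve

/-! ### A criterion for degeneration -/

namespace FilteredComplex

/-- Write `dx = dy + d(x - y)`. The first term has filtration above `a + r`, and the second is the
differential of an element of filtration `a + 1`; these are the two kinds of boundaries on the page
`r`. -/
lemma degeneratesAt_of_lift (K : CochainComplex (ModuleCat.{v} ℚ) ℕ)
    (F : ℤ → (n : ℕ) → Submodule ℚ (K.X n)) (hF : ∀ a n, F (a + 1) n ≤ F a n) (r₀ : ℤ)
    (h : ∀ r, r₀ ≤ r → ∀ a n, ∀ x ∈ F a n, (K.d n (n + 1)).hom x ∈ F (a + r) (n + 1) →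
      ∃ y, x - y ∈ F (a + 1) n ∧ (K.d n (n + 1)).hom y ∈ F (a + r + 1) (n + 1)) :
    DegeneratesAt K F r₀ := by
  intro r hr a n
  refine LinearMap.ext fun z => ?_
  obtain ⟨⟨x, hx⟩, rfl⟩ := Submodule.Quotient.mk_surjective _ z
  obtain ⟨y, hy, hdy⟩ := h r hr a n x hx.1 hx.2
  have hdd : ∀ m (w : K.X m), (K.d (m + 1) (m + 1 + 1)).hom ((K.d m (m + 1)).hom w) = 0 :=
    fun m w => by rw [← LinearMap.comp_apply, ← ModuleCat.hom_comp, K.d_comp_d]; rfl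
  refine (Submodule.Quotient.mk_eq_zero _).2 ?_
  change (K.d n (n + 1)).hom x ∈ boundaries K F r (a + r) (n + 1)
  have e : (K.d n (n + 1)).hom x = (K.d n (n + 1)).hom y + (K.d n (n + 1)).hom (x - y) := by
    rw [map_sub]; abel
  rw [e]
  refine Submodule.add_mem_sup ⟨hdy, ?_⟩ ⟨x - y, ⟨?_, ?_⟩, rfl⟩
  · change (K.d (n + 1) (n + 1 + 1)).hom _ ∈ F (a + r + 1 + (r - 1)) (n + 1 + 1)
    rw [hdd]
    exact Submodule.zero_mem _
  · rw [show a + r - r + 1 = a + 1 by ring]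
    exact hy
  · change (K.d n (n + 1)).hom (x - y) ∈ F (a + r - r + 1 + (r - 1)) (n + 1)
    rw [show a + r - r + 1 + (r - 1) = a + r by ring, map_sub]
    exact Submodule.sub_mem _ hx.2 (hF _ _ hdy)

end FilteredComplex

/-! ### From cochains on 𝒢_n^{1+q} to functions on lists -/

namespace MarkedGraph

open GroupNerve ListCochain

variable {n q : ℕ} (Φ : SingleObj (MulAut (FreeGroup (Fin n))) ⥤ ModuleCat.{v} ℚ)

/-- The element of `A_n^{1+q}` with given components. -/
def ofPair (v : (Fin q → FreeGroup (Fin n)) × MulAut (FreeGroup (Fin n))) : A n q :=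
  ⟨v.1, v.2⟩

/-- The components of an element of `A_n^{1+q}`. -/
def toPair (g : A n q) : (Fin q → FreeGroup (Fin n)) × MulAut (FreeGroup (Fin n)) :=
  (g.left, g.right)

/-- The endomorphism of `A_n^{1+q}` that makes the marked point `i` equal to the base point. -/
def collapseHom (i : Fin q) : A n q →* A n q where
  toFun g := ⟨Function.update g.left i 1, g.right⟩
  map_one' := by
    refine SemidirectProduct.ext (funext fun j => ?_) rfl
    by_cases h : j = i
    · subst h; simp
    · simp [h]
  map_mul' g h := by
    refine SemidirectProduct.ext (funext fun j => ?_) rfl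
    change Function.update (g * h).left i 1 j =
      Function.update g.left i 1 j * g.right (Function.update h.left i 1 j)
    by_cases e : j = i
    · subst e; simp
    · simp only [Function.update_of_ne e]; rfl

lemma ofPair_collapse (i : Fin q) (v : (Fin q → FreeGroup (Fin n)) × MulAut (FreeGroup (Fin n))) :
    ofPair (collapse i v) = collapseHom i (ofPair v) :=
  rfl

lemma ofPair_leftTranslate (u : Fin q → FreeGroup (Fin n))
    (v : (Fin q → FreeGroup (Fin n)) × MulAut (FreeGroup (Fin n))) :
    ofPair (leftTranslate u v) = SemidirectProduct.inl u * ofPair v := by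
  refine SemidirectProduct.ext ?_ ?_
  · simp [ofPair, leftTranslate]
  · simp [ofPair, leftTranslate]

lemma toPair_inl_mul (u : Fin q → FreeGroup (Fin n)) (g : A n q) :
    toPair (SemidirectProduct.inl u * g) = leftTranslate u (toPair g) := by
  refine Prod.ext ?_ ?_
  · simp [toPair, leftTranslate]
  · simp [toPair, leftTranslate]

/-- The cochains of the pullback to `𝒢_n^{1+q}` of a local system on `𝒢_n^1`. -/
abbrev K (q : ℕ) : CochainComplex (ModuleCat.{v} ℚ) ℕ :=
  (system (SemidirectProduct.rightHom : A n q →* _) Φ).cochains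

/-- The Serre filtration. -/
abbrev F (q : ℕ) (a : ℤ) (m : ℕ) : Submodule ℚ ((K Φ q).X m) :=
  Serre.filtration (forget n q) (system (SemidirectProduct.rightHom : A n q →* _) Φ) a m

/-- A cochain on `𝒢_n^{1+q}` in homogeneous coordinates. -/
abbrev co {m : ℕ} (c : (K Φ q).X m) (b : Fin (m + 1) → A n q) : space Φ :=
  coord SemidirectProduct.rightHom Φ c b

lemma mem_F_iff {m : ℕ} (a : ℤ) (c : (K Φ q).X m) :
    c ∈ F Φ q a m ↔ ∀ b : Fin (m + 1) → A n q,
      runs (List.ofFn fun i => (b i).right) ≤ a.toNat → co Φ c b = 0 :=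
  mem_filtration_iff _ _ _ _

section FirstPage

variable {Φ} {m : ℕ}

/-- A cochain as a function on lists of vertices. -/
def onLists (x : (K Φ q).X m)
    (l : List ((Fin q → FreeGroup (Fin n)) × MulAut (FreeGroup (Fin n)))) : space Φ :=
  if h : l.length = m + 1 then co Φ x fun i => ofPair (l.get (i.cast h.symm)) else 0

lemma onLists_ofFn (x : (K Φ q).X m)
    (b : Fin (m + 1) → (Fin q → FreeGroup (Fin n)) × MulAut (FreeGroup (Fin n))) :
    onLists x (List.ofFn b) = co Φ x fun i => ofPair (b i) := by
  rw [onLists, dif_pos (List.length_ofFn)]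
  simp only [List.get_ofFn]
  rfl

lemma onLists_of_length_ne (x : (K Φ q).X m)
    {l : List ((Fin q → FreeGroup (Fin n)) × MulAut (FreeGroup (Fin n)))} (h : l.length ≠ m + 1) :
    onLists x l = 0 :=
  dif_neg h

lemma exists_eq_ofFn {V : Type*} {l : List V} {k : ℕ} (h : l.length = k) :
    ∃ b : Fin k → V, l = List.ofFn b := by
  subst h
  exact ⟨l.get, (List.ofFn_get l).symm⟩

lemma d_onLists (x : (K Φ q).X m) :
    d (onLists x) = onLists (((K Φ q).d m (m + 1)).hom x) := by
  funext l
  by_cases h : l.length = m + 2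
  · obtain ⟨b, rfl⟩ := exists_eq_ofFn h
    rw [d_ofFn, onLists_ofFn]
    refine Eq.trans ?_ (coord_d _ _ _ _).symm
    exact Finset.sum_congr rfl fun i _ => congrArg _ (onLists_ofFn _ _)
  · rw [onLists_of_length_ne _ h]
    rcases l with _ | ⟨v, l⟩
    · rfl
    · refine d_eq_zero_of_length (n := l.length) (fun l' hl' => onLists_of_length_ne _ ?_) _ rfl
      simp only [List.length_cons] at h
      omega

lemma fil_onLists {a : ℕ} {x : (K Φ q).X m} (hx : x ∈ F Φ q a m) :
    Fil Prod.snd (a + 1) (onLists x) := by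
  intro l hl
  by_cases h : l.length = m + 1
  · obtain ⟨b, rfl⟩ := exists_eq_ofFn h
    rw [onLists_ofFn]
    refine (mem_F_iff Φ _ _).1 hx _ ?_
    rw [List.map_ofFn] at hl
    exact Nat.le_of_lt_succ hl
  · exact onLists_of_length_ne _ h

lemma onLists_map (x : (K Φ q).X m)
    (φ : (Fin q → FreeGroup (Fin n)) × MulAut (FreeGroup (Fin n)) →
      (Fin q → FreeGroup (Fin n)) × MulAut (FreeGroup (Fin n))) (ψ : A n q → A n q)
    (h : ∀ v, ofPair (φ v) = ψ (ofPair v)) (t : space Φ → space Φ) (ht : t 0 = 0)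
    (hx : ∀ b, co Φ x (ψ ∘ b) = t (co Φ x b))
    (l : List ((Fin q → FreeGroup (Fin n)) × MulAut (FreeGroup (Fin n)))) :
    onLists x (l.map φ) = t (onLists x l) := by
  by_cases hl : l.length = m + 1
  · obtain ⟨b, rfl⟩ := exists_eq_ofFn hl
    rw [List.map_ofFn, onLists_ofFn, onLists_ofFn, ← hx]
    exact congrArg _ (funext fun i => h _)
  · rw [onLists_of_length_ne _ hl, onLists_of_length_ne _ (by simpa using hl), ht]

/-- A cochain whose restriction to the normalized simplices is given by an invariant function on
lists. -/
lemma exists_co_eq (g : List ((Fin q → FreeGroup (Fin n)) × MulAut (FreeGroup (Fin n))) → space Φ)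
    (hg : ∀ u l, g (List.map (leftTranslate u) l) = g l) :
    ∃ z : (K Φ q).X m, (∀ b : Fin (m + 1) → A n q, (b 0).right = 1 →
        co Φ z b = g (List.ofFn fun i => toPair (b i))) ∧
      ∀ a : ℕ, Fil Prod.snd (a + 1) g → z ∈ F Φ q a m := by
  -- The function `g` need not be equivariant under Aut(F_n). Translating the first vertex to 1,
  -- applying `g` and acting back forces equivariance.
  obtain ⟨z, hz⟩ := exists_coord_eq (SemidirectProduct.rightHom : A n q →* _) Φ
    (fun b : Fin (m + 1) → A n q =>
      action Φ (b 0).right (g (List.ofFn fun i => toPair ((b 0)⁻¹ * b i)))) (fun g b => by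
        rw [← action_mul]
        simp only [mul_inv_rev, mul_assoc, inv_mul_cancel_left]
        rfl)
  refine ⟨z, fun b hb => ?_, fun a ha => (mem_F_iff Φ _ _).2 fun b hb => ?_⟩
  · have h₁ : (b 0)⁻¹ = SemidirectProduct.inl (b 0).left⁻¹ := by
      have : b 0 = SemidirectProduct.inl (b 0).left := SemidirectProduct.ext rfl hb
      rw [map_inv, ← this]
    rw [co, hz]
    simp only [hb, action_one, h₁, toPair_inl_mul]
    rw [← hg (b 0).left⁻¹ (List.ofFn fun i => toPair (b i)), List.map_ofFn]
    rfl
  · rw [co, hz]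
    simp only
    rw [ha, map_zero]
    rw [List.map_ofFn, Nat.lt_succ_iff]
    refine le_trans (le_of_eq ?_) hb
    rw [← runs_map_of_injective _ (mul_right_injective (b 0).right⁻¹)
      (List.ofFn fun i => (b i).right), List.map_ofFn]
    rfl

end FirstPage

end MarkedGraph

/-! ### One row for each set of marked points, and the lifting property -/

namespace MarkedGraph

open GroupNerve ListCochain

variable {n q : ℕ} (Φ : SingleObj (MulAut (FreeGroup (Fin n))) ⥤ ModuleCat.{v} ℚ) {m : ℕ}

lemma co_sub (c c' : (K Φ q).X m) (b : Fin (m + 1) → A n q) :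
    co Φ (c - c') b = co Φ c b - co Φ c' b :=
  coord_sub _ _ _ _ _

lemma mem_F_of_normalized (a : ℤ) (c : (K Φ q).X m)
    (h : ∀ b : Fin (m + 1) → A n q, b 0 = 1 →
      runs (List.ofFn fun i => (b i).right) ≤ a.toNat → co Φ c b = 0) : c ∈ F Φ q a m := by
  refine (mem_F_iff Φ a c).2 fun b hb => ?_
  have h₁ : co Φ c (fun i => b 0 * ((b 0)⁻¹ * b i)) = _ := coord_mul_left _ _ _ _ _
  simp only [mul_inv_cancel_left] at h₁
  have h₂ : co Φ c (fun i => (b 0)⁻¹ * b i) = 0 := h _ (inv_mul_cancel _) ?_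
  · exact h₁.trans ((congrArg _ h₂).trans (map_zero _))
  refine le_trans (le_of_eq ?_) hb
  rw [← runs_map_of_injective _ (mul_right_injective (b 0).right⁻¹)
    (List.ofFn fun i => (b i).right), List.map_ofFn]
  rfl

/-- `Int.toNat` makes the filtration constant in indices at most 0. -/
lemma F_of_neg {a : ℤ} (ha : a < 0) (x : (K Φ q).X m) (hx : x ∈ F Φ q a m) :
    x ∈ F Φ q (a + 1) m := by
  rw [mem_F_iff] at hx ⊢
  rwa [Int.toNat_of_nonpos (by omega), ← Int.toNat_of_nonpos ha.le]

/-- The vanishing of the first page outside of the row `#S` for the part of the cochains that is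
reduced at the marked points in `S` and independent of the other ones. -/
theorem exists_sub_d_mem_F (a : ℤ) (S : Finset (Fin q)) (x : (K Φ q).X m) (hx : x ∈ F Φ q a m)
    (hdx : ((K Φ q).d m (m + 1)).hom x ∈ F Φ q (a + 1) (m + 1))
    (hS : ∀ i ∈ S, ∀ b, co Φ x (collapseHom i ∘ b) = 0)
    (hS' : ∀ i ∉ S, ∀ b, co Φ x (collapseHom i ∘ b) = co Φ x b)
    (hm : (m : ℤ) ≠ a + S.card) :
    ∃ z ∈ F Φ q a (m - 1), x - ((K Φ q).d (m - 1) m).hom z ∈ F Φ q (a + 1) m := by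
  rcases lt_or_ge a 0 with ha | ha
  · exact ⟨0, Submodule.zero_mem _, by rw [map_zero, sub_zero]; exact F_of_neg Φ ha x hx⟩
  obtain ⟨k, rfl⟩ := Int.eq_ofNat_of_zero_le ha
  -- Both indices shift by one: filtration `k` means at least `k + 1` runs, and an `m`-simplex is a
  -- list of `m + 1` vertices.
  obtain ⟨g, hg, hgu, hfg⟩ := exists_fil_sub_d_of_reduced (k + 1) (by omega) S (onLists x)
    (fil_onLists hx) (by rw [d_onLists]; exact fil_onLists (by exact_mod_cast hdx))
    (fun u l => onLists_map x _ (fun g => SemidirectProduct.inl u * g) (ofPair_leftTranslate u) id rfl (fun b => by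
      refine (coord_mul_left _ _ _ _ _).trans ?_
      rw [SemidirectProduct.rightHom_inl, action_one]; rfl) l)
    (fun i hi l => onLists_map x _ _ (ofPair_collapse i) (fun _ => 0) rfl (hS i hi) l)
    (fun i hi l => onLists_map x _ _ (ofPair_collapse i) id rfl (hS' i hi) l)
    (fun l hl => onLists_of_length_ne x (by omega))
  have hfx : ∀ b : Fin (m + 1) → A n q, runs (List.ofFn fun i => (b i).right) ≤ k + 1 →
      co Φ x b = d g (List.ofFn fun i => toPair (b i)) := fun b hb => by
    have h₁ := hfg (List.ofFn fun i => toPair (b i))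
      (by rw [List.map_ofFn]; exact Nat.lt_succ_of_le hb)
    rw [← sub_eq_zero, ← h₁]
    simp only [onLists_ofFn]
    rfl
  have hk : ((k : ℤ) + 1).toNat = k + 1 := by omega
  rcases m with _ | m
  -- In degree 0 the index `m - 1` is again 0 and the incoming differential is zero. The only face
  -- of a vertex is the empty list, where `g` vanishes.
  · refine ⟨0, Submodule.zero_mem _, ?_⟩
    rw [map_zero, sub_zero]
    refine (mem_F_iff Φ _ _).2 fun b hb => ?_
    rw [hfx b (hk ▸ hb)]
    simp only [List.ofFn_succ, List.ofFn_zero, d_cons, d_nil, sub_zero]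
    exact hg [] (by simp [runs])
  · obtain ⟨z, hz, hzF⟩ := exists_co_eq (Φ := Φ) (m := m) g hgu
    refine ⟨z, hzF k hg, mem_F_of_normalized Φ _ _ fun b hb₀ hb => ?_⟩
    rw [hk] at hb
    rw [co_sub, hfx b hb, sub_eq_zero, d_ofFn]
    refine Eq.trans ?_ (coord_d _ _ _ _).symm
    refine Finset.sum_congr rfl fun i _ => congrArg _ ?_
    -- Only the face omitting the first vertex can leave the normalized lists, where `z` is given by
    -- `g`. If it does, a whole run has been removed, and both `z` and `g` vanish there by their
    -- filtration.
    by_cases h : ((b ∘ i.succAbove) 0).right = 1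
    · exact (hz _ h).symm
    · have hi : i = 0 := by
        by_contra hi
        refine h ?_
        rw [Function.comp_apply, Fin.succAbove_ne_zero_zero hi, hb₀]
        rfl
      subst hi
      have hruns : runs (List.ofFn fun i : Fin (m + 1) => (b i.succ).right) ≤ k := by
        rw [List.ofFn_succ, runs_cons_of_head_ne] at hb
        · omega
        · rw [List.ofFn_succ, hb₀]
          simpa using h
      have hz₀ : co Φ z (b ∘ Fin.succAbove 0) = 0 := (mem_F_iff Φ _ _).1 (hzF k hg) _ hruns
      refine Eq.trans (hg _ ?_) hz₀.symm
      rw [List.map_ofFn]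
      exact Nat.lt_succ_of_le hruns

/-- The endomorphism of the cochains induced by `collapseHom i`. -/
def collapseCochain (i : Fin q) (x : (K Φ q).X m) : (K Φ q).X m :=
  ofValues _ Φ fun σ => value _ Φ x ((nerveMap (collapseHom i).toFunctor).app (op ⦋m⦌) σ)

variable {Φ}

lemma co_collapseCochain (i : Fin q) (x : (K Φ q).X m) (b : Fin (m + 1) → A n q) :
    co Φ (collapseCochain Φ i x) b = co Φ x (collapseHom i ∘ b) := by
  rw [co, coord, collapseCochain, value_ofValues, nerveMap_simplex]
  rfl

lemma collapseCochain_mem_F (i : Fin q) {a : ℤ} {x : (K Φ q).X m} (hx : x ∈ F Φ q a m) :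
    collapseCochain Φ i x ∈ F Φ q a m := by
  rw [mem_F_iff] at hx ⊢
  intro b hb
  rw [co_collapseCochain]
  exact hx _ hb

lemma d_collapseCochain (i : Fin q) (x : (K Φ q).X m) :
    ((K Φ q).d m (m + 1)).hom (collapseCochain Φ i x) =
      collapseCochain Φ i (((K Φ q).d m (m + 1)).hom x) := by
  refine coord_injective _ _ (funext fun b => ?_)
  refine (coord_d _ _ _ _).trans (Eq.trans ?_ (co_collapseCochain i _ b).symm)
  refine Eq.trans ?_ (coord_d _ _ _ _).symm
  exact Finset.sum_congr rfl fun j _ => congrArg _ (co_collapseCochain i x _)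

lemma collapseHom_collapseHom (i : Fin q) (g : A n q) :
    collapseHom i (collapseHom i g) = collapseHom i g :=
  congrArg ofPair (collapse_collapse i (toPair g))

lemma collapseHom_comm (i j : Fin q) (g : A n q) :
    collapseHom i (collapseHom j g) = collapseHom j (collapseHom i g) :=
  congrArg ofPair (collapse_comm i j (toPair g))

lemma F_antitone (a b : ℤ) (h : a ≤ b) : F Φ q b m ≤ F Φ q a m := by
  intro x hx
  rw [mem_F_iff] at hx ⊢
  exact fun c hc => hx c (hc.trans (Int.toNat_le_toNat h))

/-- A cochain that defines a class on the page `E_r` can be changed in higher filtration so that its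
differential has higher filtration: the case where the cochain is reduced at the marked points in
`S` and independent of the other ones. -/
lemma exists_lift_of_reduced (r : ℤ) (hr : 2 ≤ r) (a : ℤ) (S : Finset (Fin q)) (x : (K Φ q).X m)
    (hx : x ∈ F Φ q a m) (hdx : ((K Φ q).d m (m + 1)).hom x ∈ F Φ q (a + r) (m + 1))
    (hS : ∀ i ∈ S, ∀ b, co Φ x (collapseHom i ∘ b) = 0)
    (hS' : ∀ i ∉ S, ∀ b, co Φ x (collapseHom i ∘ b) = co Φ x b) :
    ∃ y, x - y ∈ F Φ q (a + 1) m ∧ ((K Φ q).d m (m + 1)).hom y ∈ F Φ q (a + r + 1) (m + 1) := by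
  have hdd : ∀ l k j (w : (K Φ q).X l), ((K Φ q).d k j).hom (((K Φ q).d l k).hom w) = 0 :=
    fun l k j w => by rw [← LinearMap.comp_apply, ← ModuleCat.hom_comp, (K Φ q).d_comp_d]; rfl
  -- If `x` lies in the row `#S`, then `dx` lies in the row `#S - r + 1`, which differs as `r ≥ 2`;
  -- so `dx` is `dz` up to higher filtration and `x - z` is the lift. If `x` lies in another row, it
  -- is itself a coboundary up to higher filtration, and that coboundary is the lift.
  by_cases hm : (m : ℤ) = a + S.card
  · have hco : ∀ b, co Φ (((K Φ q).d m (m + 1)).hom x) b = _ := fun b => coord_d _ _ _ _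
    obtain ⟨(z : (K Φ q).X m), hz, hxz⟩ := exists_sub_d_mem_F Φ (a + r) S (((K Φ q).d m (m + 1)).hom x) hdx
      (by rw [hdd]; exact Submodule.zero_mem _)
      (fun i hi b => by
        rw [hco]
        exact Finset.sum_eq_zero fun j _ => by
          refine (congrArg _ ?_).trans (smul_zero _)
          exact hS i hi (b ∘ j.succAbove))
      (fun i hi b => by
        rw [hco, hco]
        exact Finset.sum_congr rfl fun j _ => congrArg _ (hS' i hi (b ∘ j.succAbove)))
      (by push_cast; omega)
    refine ⟨x - z, ?_, ?_⟩
    · rw [sub_sub_cancel]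
      exact F_antitone _ _ (by omega) hz
    · rw [map_sub]
      exact hxz
  · obtain ⟨z, hz, hxz⟩ := exists_sub_d_mem_F Φ a S x hx (F_antitone _ _ (by omega) hdx) hS hS' hm
    refine ⟨_, hxz, ?_⟩
    rw [hdd]
    exact Submodule.zero_mem _

/-- `T` contains the marked points at which `x` is not yet known to be reduced or independent. For
each of them `x` splits as its collapse, which is independent of the point, plus the rest, which is
reduced there. Because the idempotents commute, this preserves what is known at the other points,
and lifts of the two parts add up. -/
lemma exists_lift (r : ℤ) (hr : 2 ≤ r) (a : ℤ) (T : Finset (Fin q)) (x : (K Φ q).X m)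
    (hx : x ∈ F Φ q a m) (hdx : ((K Φ q).d m (m + 1)).hom x ∈ F Φ q (a + r) (m + 1))
    (hT : ∀ i ∉ T, (∀ b, co Φ x (collapseHom i ∘ b) = 0) ∨
      ∀ b, co Φ x (collapseHom i ∘ b) = co Φ x b) :
    ∃ y, x - y ∈ F Φ q (a + 1) m ∧ ((K Φ q).d m (m + 1)).hom y ∈ F Φ q (a + r + 1) (m + 1) := by
  classical
  induction T using Finset.induction_on generalizing x with
  | empty =>
    refine exists_lift_of_reduced r hr a
      (Finset.univ.filter fun i => ∀ b, co Φ x (collapseHom i ∘ b) = 0) x hx hdx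
      (fun i hi => (Finset.mem_filter.1 hi).2) fun i hi => ?_
    exact (hT i (by simp)).resolve_left fun h => hi (Finset.mem_filter.2 ⟨Finset.mem_univ i, h⟩)
  | insert i T hi ih =>
    have hcomm : ∀ (j : Fin q) (b : Fin (m + 1) → A n q),
        collapseHom i ∘ collapseHom j ∘ b = collapseHom j ∘ collapseHom i ∘ b := fun j b =>
      funext fun _ => collapseHom_comm i j _
    have hidem : ∀ b : Fin (m + 1) → A n q,
        collapseHom i ∘ collapseHom i ∘ b = collapseHom i ∘ b := fun b =>
      funext fun _ => collapseHom_collapseHom i _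
    have hdx' := collapseCochain_mem_F i hdx
    rw [← d_collapseCochain] at hdx'
    obtain ⟨y₁, hy₁, hdy₁⟩ := ih (collapseCochain Φ i x) (collapseCochain_mem_F i hx) hdx'
      (fun j hj => by
        simp only [co_collapseCochain]
        by_cases h : j = i
        · subst h
          exact Or.inr fun b => by rw [hidem]
        · refine (hT j (by simp [h, hj])).imp (fun h b => ?_) fun h b => ?_
          · rw [hcomm, h]
          · rw [hcomm, h])
    obtain ⟨y₂, hy₂, hdy₂⟩ := ih (x - collapseCochain Φ i x)
      (Submodule.sub_mem _ hx (collapseCochain_mem_F i hx))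
      (by rw [map_sub]; exact Submodule.sub_mem _ hdx hdx')
      (fun j hj => by
        simp only [co_sub, co_collapseCochain]
        by_cases h : j = i
        · subst h
          exact Or.inl fun b => by rw [hidem, sub_self]
        · refine (hT j (by simp [h, hj])).imp (fun h b => ?_) fun h b => ?_
          · rw [hcomm, h, h, sub_zero]
          · rw [hcomm, h, h])
    refine ⟨y₁ + y₂, ?_, ?_⟩
    · rw [show x - (y₁ + y₂) = (collapseCochain Φ i x - y₁) + (x - collapseCochain Φ i x - y₂) by
        abel]
      exact Submodule.add_mem _ hy₁ hy₂
    · rw [map_add]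
      exact Submodule.add_mem _ hdy₁ hdy₂

end MarkedGraph

end

theorem mainTheorem6 (n p q : ℕ) (V : Type*) [AddCommGroup V] [Module ℚ V] :
    Serre.DegeneratesAtE₂ (MarkedGraph.forget n q)
      (LocalSystem.pullback (MarkedGraph.forget n q) (MarkedGraph.coefficients n p V)) :=
  FilteredComplex.degeneratesAt_of_lift _ _
    (fun a _ => MarkedGraph.F_antitone (Φ := MarkedGraph.coefficientFunctor n p V) a (a + 1)
      (by omega)) 2
    fun r hr a _ x hx hdx =>
      MarkedGraph.exists_lift (Φ := MarkedGraph.coefficientFunctor n p V) r hr a Finset.univ x hx hdx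
        (fun i hi => absurd (Finset.mem_univ i) hi)
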